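/- Let $n\ge 0$ and $N\ge 1$, let $\Omega\subset\mathbb R^n$ be open, $T>0$ and $\Omega_T=\Omega\times(0,T)$. Let $\Phi:\mathbb R^N\to\mathbb R$ be twice continuously differentiable with $$\lambda|\xi|^2\le \Phi_{z_iz_j}(z)\,\xi^i\xi^j\le\Lambda|\xi|^2\qquad\text{for all } z,\xi\in\mathbb R^N,$$ where $\lambda>0$, and suppose that $\Phi(z)=\varphi(|z|)$ for some function $\varphi$. Let $V(\Omega_T;\mathbb R^N)$ be the closure of the $C^1(\Omega_T;\mathbb R^N)$ functions of finite norm under $$\|v\|_V^2=\operatorname*{ess\,sup}_{0<t<T}\int_\Omega|v(x,t)|^2\,dx+\iint_{\Omega_T}|\nabla v|^2\,dx\,dt ,$$ where $\nabla$ is the gradient in $x$, and let $H^1_0(\Omega_T)$ be the closure of $C_c^\infty(\Omega_T)$ in $H^1(\Omega_T)$. Let $u$ be a bounded weak solution of the diffusion system $u_t-\Delta[\nabla\Phi(u)]=0$ in $\Omega_T$, that is, $u\in V(\Omega_T;\mathbb R^N)$ is essentially bounded and $$\iint_{\Omega_T}-u^iw^i_t+(\Phi_{z_i}(u))_{x_\alpha}w^i_{x_\alpha}\,dx\,dt=0\qquad\text{for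 all } w\in H^1_0(\Omega_T;\mathbb R^N).$$ Then there is a continuously differentiable, strictly increasing function $\gamma:\mathbb R\to\mathbb R$ with $$\gamma(\varphi(z))=\tfrac12\,\varphi'(z)^2\qquad\text{for all } z\ge 0$$ (with the one-sided derivative at $z=0$) such that $\varphi(|u|)$ weakly satisfies $$\varphi_t-\Delta(\gamma(\varphi))+\lambda^2|\nabla u|^2\le 0\quad\text{in }\Omega_T .$$ The last assertion means the following: $\gamma(\varphi(|u|))$ has a weak spatial gradient in $L^2(\Omega_T)$, and for every $v\in H^1_0(\Omega_T)$ with $v\ge0$ a.e. and $\varphi(|u|)\,v_t\in L^1(\Omega_T)$ (which is automatic if $\Omega$ has finite measure, or if $\Phi(0)=0$), the function $|\nabla u|^2v$ is integrable over $\Omega_T$ and $$\iint_{\Omega_T}-\varphi(|u|)\,v_t+\nabla\big(\gamma(\varphi(|u|))\big)\cdot\nabla v+\lambda^2|\nabla u|^2\,v\,dx\,dt\le 0 .$$ -/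

import Mathlib

open MeasureTheory Filter Topology Set
open scoped ContDiff

namespace DiffusionSystem

/-- Space-time `ℝⁿ × ℝ`; a point is `(x, t)`. -/
abbrev SpaceTime (n : ℕ) : Type := EuclideanSpace ℝ (Fin n) × ℝ

/-- The cylinder `Ω_T = Ω × (0, T)`. -/
def cylinder {n : ℕ} (Ω : Set (EuclideanSpace ℝ (Fin n))) (T : ℝ) : Set (SpaceTime n) :=
  Ω ×ˢ Ioo (0 : ℝ) T

/-- The unit vector in the spatial direction `x_α`. -/
noncomputable def xDir {n : ℕ} (α : Fin n) : SpaceTime n := (EuclideanSpace.single α (1 : ℝ), 0)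

/-- The unit vector in the time direction. -/
def tDir (n : ℕ) : SpaceTime n := (0, 1)

/-- `ψ ∈ C_c^∞(O; F)`. -/
def IsTestFunction {n : ℕ} {F : Type*} [NormedAddCommGroup F] [NormedSpace ℝ F]
    (O : Set (SpaceTime n)) (ψ : SpaceTime n → F) : Prop :=
  ContDiff ℝ ∞ ψ ∧ HasCompactSupport ψ ∧ tsupport ψ ⊆ O

/-- `g` is the weak (distributional) derivative of `f` on `O` in the direction `e`. -/
def HasWeakDeriv {n : ℕ} {F : Type*} [NormedAddCommGroup F] [NormedSpace ℝ F]
    (O : Set (SpaceTime n)) (e : SpaceTime n) (f g : SpaceTime n → F) : Prop :=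
  LocallyIntegrableOn f O volume ∧ LocallyIntegrableOn g O volume ∧
    ∀ ψ : SpaceTime n → ℝ, IsTestFunction O ψ →
      ∫ p in O, (fderiv ℝ ψ p e) • f p = - ∫ p in O, ψ p • g p

/-- `Df` is the weak spatial gradient of `f` on `O`; `Df α` is the derivative along `x_α`. -/
def HasWeakGrad {n : ℕ} {F : Type*} [NormedAddCommGroup F] [NormedSpace ℝ F]
    (O : Set (SpaceTime n)) (f : SpaceTime n → F) (Df : Fin n → SpaceTime n → F) : Prop :=
  ∀ α, HasWeakDeriv O (xDir α) f (Df α)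

/-- `|∇f|² = ∑_α |f_{x_α}|²`, for a gradient given by its components. -/
noncomputable def gradSq {n : ℕ} {F : Type*} [NormedAddCommGroup F]
    (Df : Fin n → SpaceTime n → F) (p : SpaceTime n) : ℝ :=
  ∑ α, ‖Df α p‖ ^ 2

/-- `w ∈ H¹₀(O; F)`, the closure of `C_c^∞(O; F)` in `H¹(O; F)`, where `wt` and `Dw` are the time
derivative and the spatial gradient of `w`, the `L²` limits of those of the approximations. -/
def MemH10 {n : ℕ} {F : Type*} [NormedAddCommGroup F] [NormedSpace ℝ F]
    (O : Set (SpaceTime n)) (w wt : SpaceTime n → F) (Dw : Fin n → SpaceTime n → F) : Prop :=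
  MemLp w 2 (volume.restrict O) ∧ MemLp wt 2 (volume.restrict O) ∧
    (∀ α, MemLp (Dw α) 2 (volume.restrict O)) ∧
    ∃ W : ℕ → SpaceTime n → F, (∀ k, IsTestFunction O (W k)) ∧
      Tendsto (fun k => eLpNorm (fun p => W k p - w p) 2 (volume.restrict O)) atTop (𝓝 0) ∧
      Tendsto (fun k => eLpNorm (fun p => fderiv ℝ (W k) p (tDir n) - wt p) 2
        (volume.restrict O)) atTop (𝓝 0) ∧
      ∀ α, Tendsto (fun k => eLpNorm (fun p => fderiv ℝ (W k) p (xDir α) - Dw α p) 2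
        (volume.restrict O)) atTop (𝓝 0)

/-- The squared norm `sup_{0<t<T} ∫_Ω |f(x,t)|² dx + ∬_{Ω_T} |∇f|² dx dt`, with `∇f` given as `Df`.
The supremum is the essential one, as `f` is determined up to null sets only; for continuous `f`
the two agree, because `t ↦ ∫_Ω |f(x,t)|² dx` is then lower semicontinuous. -/
noncomputable def vNormSq {n : ℕ} {F : Type*} [NormedAddCommGroup F]
    (Ω : Set (EuclideanSpace ℝ (Fin n))) (T : ℝ)
    (f : SpaceTime n → F) (Df : Fin n → SpaceTime n → F) : ENNReal :=
  essSup (fun t : ℝ => ∫⁻ x in Ω, ‖f (x, t)‖ₑ ^ 2) (volume.restrict (Ioo (0 : ℝ) T)) +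
    ∑ α, ∫⁻ p in cylinder Ω T, ‖Df α p‖ₑ ^ 2

/-- `u ∈ V(Ω_T; F)`: the closure of the `C¹(Ω_T; F)` functions of finite norm `vNormSq`. -/
def MemV {n : ℕ} {F : Type*} [NormedAddCommGroup F] [NormedSpace ℝ F]
    (Ω : Set (EuclideanSpace ℝ (Fin n))) (T : ℝ) (u : SpaceTime n → F) : Prop :=
  AEStronglyMeasurable u (volume.restrict (cylinder Ω T)) ∧
    ∃ Du : Fin n → SpaceTime n → F, HasWeakGrad (cylinder Ω T) u Du ∧
      ∃ U : ℕ → SpaceTime n → F, (∀ k, ContDiffOn ℝ 1 (U k) (cylinder Ω T)) ∧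
        (∀ k, vNormSq Ω T (U k) (fun α p => fderiv ℝ (U k) p (xDir α)) < ⊤) ∧
        Tendsto (fun k => vNormSq Ω T (fun p => U k p - u p)
          (fun α p => fderiv ℝ (U k) p (xDir α) - Du α p)) atTop (𝓝 0)

/-- `Φ` is `C²` with `lam |ξ|² ≤ Φ_{z_i z_j} ξ^i ξ^j ≤ Lam |ξ|²`, where `lam > 0`. -/
def IsUniformlyConvex {N : ℕ} (Φ : EuclideanSpace ℝ (Fin N) → ℝ) (lam Lam : ℝ) : Prop :=
  0 < lam ∧ ContDiff ℝ 2 Φ ∧ ∀ z ξ : EuclideanSpace ℝ (Fin N),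
    lam * ‖ξ‖ ^ 2 ≤ iteratedFDeriv ℝ 2 Φ z ![ξ, ξ] ∧
      iteratedFDeriv ℝ 2 Φ z ![ξ, ξ] ≤ Lam * ‖ξ‖ ^ 2

/-- `u` is a weak solution of `u_t - Δ[∇Φ(u)] = 0` in `Ω_T`: `u ∈ V(Ω_T; ℝᴺ)` and
`∬ -u^i w^i_t + (Φ_{z_i}(u))_{x_α} w^i_{x_α} = 0` for all `w ∈ H¹₀(Ω_T; ℝᴺ)`. -/
def IsWeakSolution {n N : ℕ} (Ω : Set (EuclideanSpace ℝ (Fin n))) (T : ℝ)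
    (Φ : EuclideanSpace ℝ (Fin N) → ℝ) (u : SpaceTime n → EuclideanSpace ℝ (Fin N)) : Prop :=
  MemV Ω T u ∧ ∃ Dv : Fin n → SpaceTime n → EuclideanSpace ℝ (Fin N),
    HasWeakGrad (cylinder Ω T) (fun p => gradient Φ (u p)) Dv ∧
    ∀ (w wt : SpaceTime n → EuclideanSpace ℝ (Fin N))
      (Dw : Fin n → SpaceTime n → EuclideanSpace ℝ (Fin N)),
      MemH10 (cylinder Ω T) w wt Dw →
        ∫ p in cylinder Ω T, (- inner ℝ (u p) (wt p) + ∑ α, inner ℝ (Dv α p) (Dw α p)) = 0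

/-- `u` is (essentially) bounded on `Ω_T`. -/
def IsBoundedOn {n N : ℕ} (Ω : Set (EuclideanSpace ℝ (Fin n))) (T : ℝ)
    (u : SpaceTime n → EuclideanSpace ℝ (Fin N)) : Prop :=
  ∃ M : ℝ, ∀ᵐ p ∂(volume.restrict (cylinder Ω T)), ‖u p‖ ≤ M

/-- `f` weakly satisfies `f_t - Δ(γ(f)) + g ≤ 0` in `Ω_T`: `γ(f)` has a weak spatial gradient `G` in
`L²(Ω_T)`, and `∬ -f v_t + G · ∇v + g v ≤ 0` for all nonnegative `v ∈ H¹₀(Ω_T)`. It is part of the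
claim that `g v` is integrable. The requirement that `f v_t` is integrable is only
there for domains of infinite measure, on which a bounded `f` need not be square integrable. -/
def WeaklySatisfiesLE {n : ℕ} (Ω : Set (EuclideanSpace ℝ (Fin n))) (T : ℝ)
    (γ : ℝ → ℝ) (f g : SpaceTime n → ℝ) : Prop :=
  ∃ G : Fin n → SpaceTime n → ℝ,
    HasWeakGrad (cylinder Ω T) (fun p => γ (f p)) G ∧
    (∀ α, MemLp (G α) 2 (volume.restrict (cylinder Ω T))) ∧
    ∀ (v vt : SpaceTime n → ℝ) (Dv : Fin n → SpaceTime n → ℝ),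
      MemH10 (cylinder Ω T) v vt Dv →
      (∀ᵐ p ∂(volume.restrict (cylinder Ω T)), 0 ≤ v p) →
      IntegrableOn (fun p => f p * vt p) (cylinder Ω T) →
        IntegrableOn (fun p => g p * v p) (cylinder Ω T) ∧
        ∫ p in cylinder Ω T, (- (f p * vt p) + ∑ α, G α p * Dv α p + g p * v p) ≤ 0

end DiffusionSystem

/-! Formally the system is tested with `ψ ∇Φ(u)`, where `ψ ≥ 0`. The time term becomes `ψ ∂ₜΦ(u)`.
The space term splits into `∇(½|∇Φ(u)|²)·∇ψ` and `ψ |∇(∇Φ(u))|²`, and the latter is at least `λ² ψ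
|∇u|²`, since `D²Φ ≥ λ` forces `|D²Φ ξ| ≥ λ|ξ|`. For radial `Φ` the quantity `½|∇Φ|²` is a function
of `Φ` alone: `γ' = φ'' ∘ φ⁻¹` gives `γ(φ) = ½ φ'²` on `[0, ∞)`, see `exists_gamma`.

The obstacle is that `w = ψ ∇Φ(u)` has no weak time derivative. `energy_inequality` avoids it. For
`C¹` approximations `Wₖ` of `w`, the weak equation gives the derivative in `s` of `∫ u · Wₖ(· + s
e)`, `e` being the time direction, as a pairing of spatial gradients, which converges jointly as `k
→ ∞` and `s → 0`. The mean value theorem and the limit in `k` bound the increment of `∫ u · w(· + s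
e)` from below. Moving the translation onto `u` and using convexity, `∇Φ(a)·(b - a) ≤ Φ(b) - Φ(a)`,
bounds the same increment from above by that of `∫ Φ(u) ψ(· + s e)`, which is differentiable because
`ψ` is smooth. Only an inequality is needed, so one-sided difference quotients suffice.

This settles smooth `ψ ≥ 0` (`IsWeakSolution.test_inequality`). For nonnegative `v` in `H¹₀` the
smooth approximations may change sign; composing them with `√(s² + ε²) - ε` makes them nonnegative
and keeps the `H¹` convergence, because weak derivatives of `v` vanish a.e. on `{v = 0}`. Fatou's
lemma then yields integrability of `|∇u|² v` together with the inequality.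

On domains of infinite measure `Φ(u)` need not be in `L²`, so the argument uses `Φ(u) - Φ(0)`; the
constant is restored by `MemH10.integral_time_deriv_eq_zero`. -/

namespace DiffusionSystem

/-! ### Convexity and radial symmetry of `Φ` -/

section Calculus

variable {E : Type*} [NormedAddCommGroup E] [InnerProductSpace ℝ E]

theorem contDiff_gradient [CompleteSpace E] {Φ : E → ℝ} (hΦ : ContDiff ℝ 2 Φ) :
    ContDiff ℝ 1 (gradient Φ) := by
  have h : ContDiff ℝ 1 (fderiv ℝ Φ) := hΦ.fderiv_right (by norm_num)
  let L : (E →L[ℝ] ℝ) ≃ₗᵢ[ℝ] E := (InnerProductSpace.toDual ℝ E).symm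
  exact L.contDiff.comp h

theorem hasDerivAt_line {Φ : E → ℝ} (hΦ : ContDiff ℝ 2 Φ) (a ξ : E) (s : ℝ) :
    HasDerivAt (fun s : ℝ => Φ (a + s • ξ)) (fderiv ℝ Φ (a + s • ξ) ξ) s := by
  have h1 : HasDerivAt (fun s : ℝ => a + s • ξ) ξ s := by
    simpa using ((hasDerivAt_id s).smul_const ξ).const_add a
  exact ((hΦ.differentiable (by norm_num) _).hasFDerivAt).comp_hasDerivAt s h1

theorem hasDerivAt_fderiv_line {Φ : E → ℝ} (hΦ : ContDiff ℝ 2 Φ) (a ξ : E) (s : ℝ) :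
    HasDerivAt (fun s : ℝ => fderiv ℝ Φ (a + s • ξ) ξ)
      (fderiv ℝ (fderiv ℝ Φ) (a + s • ξ) ξ ξ) s := by
  have h1 : HasDerivAt (fun s : ℝ => a + s • ξ) ξ s := by
    simpa using ((hasDerivAt_id s).smul_const ξ).const_add a
  have h : ContDiff ℝ 1 (fderiv ℝ Φ) := hΦ.fderiv_right (by norm_num)
  have h2 := ((h.differentiable (by norm_num) (a + s • ξ)).hasFDerivAt).comp_hasDerivAt s h1
  simpa using h2.clm_apply (hasDerivAt_const s ξ)

/-- A `C²` function with nonnegative Hessian lies above its tangent planes. -/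
theorem inner_gradient_le_sub [CompleteSpace E] {Φ : E → ℝ} (hΦ : ContDiff ℝ 2 Φ)
    (h : ∀ z ξ, 0 ≤ fderiv ℝ (fderiv ℝ Φ) z ξ ξ) (a b : E) :
    inner ℝ (gradient Φ a) (b - a) ≤ Φ b - Φ a := by
  have hd := hasDerivAt_line hΦ a (b - a)
  have hd2 := hasDerivAt_fderiv_line hΦ a (b - a)
  have hder : deriv (fun s : ℝ => Φ (a + s • (b - a))) =
      fun s => fderiv ℝ Φ (a + s • (b - a)) (b - a) := funext fun s => (hd s).deriv
  have hconv : ConvexOn ℝ univ (fun s : ℝ => Φ (a + s • (b - a))) := by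
    apply convexOn_of_deriv2_nonneg convex_univ
    · exact fun s _ => (hd s).continuousAt.continuousWithinAt
    · exact fun s _ => (hd s).differentiableAt.differentiableWithinAt
    · rw [hder]
      exact fun s _ => (hd2 s).differentiableAt.differentiableWithinAt
    · intro s _
      rw [Function.iterate_succ, Function.iterate_one, Function.comp_apply, hder, (hd2 s).deriv]
      exact h _ _
  have := hconv.le_slope_of_hasDerivAt (mem_univ 0) (mem_univ 1) one_pos (hd 0)
  rw [inner_gradient_left]
  simpa [slope_def_field] using this

theorem inner_fderiv_gradient [CompleteSpace E] {Φ : E → ℝ} (hΦ : ContDiff ℝ 2 Φ) (z ξ η : E) :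
    inner ℝ (fderiv ℝ (gradient Φ) z ξ) η = fderiv ℝ (fderiv ℝ Φ) z ξ η := by
  have h1 : HasFDerivAt (gradient Φ) (fderiv ℝ (gradient Φ) z) z :=
    ((contDiff_gradient hΦ).differentiable (by norm_num) z).hasFDerivAt
  have h2 := h1.inner ℝ (hasFDerivAt_const η z)
  have h : ContDiff ℝ 1 (fderiv ℝ Φ) := hΦ.fderiv_right (by norm_num)
  have h3 := ((h.differentiable (by norm_num) z).hasFDerivAt).clm_apply (hasFDerivAt_const η z)
  have h4 : (fun y => inner ℝ (gradient Φ y) η) = fun y => fderiv ℝ Φ y η :=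
    funext fun y => inner_gradient_left
  rw [h4] at h2
  have := congrArg (fun L => L ξ) (h2.unique h3)
  simpa using this

/-- Cauchy–Schwarz applied to `⟪D²Φ ξ, ξ⟫ ≥ lam |ξ|²`. Squared, this is the source of the factor
`λ²` in the theorem. -/
theorem mul_norm_le_norm_fderiv_gradient [CompleteSpace E] {Φ : E → ℝ} (hΦ : ContDiff ℝ 2 Φ)
    {lam : ℝ} (h : ∀ z ξ, lam * ‖ξ‖ ^ 2 ≤ fderiv ℝ (fderiv ℝ Φ) z ξ ξ) (z ξ : E) :
    lam * ‖ξ‖ ≤ ‖fderiv ℝ (gradient Φ) z ξ‖ := by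
  rcases eq_or_ne ξ 0 with rfl | hξ
  · simp
  have h1 := h z ξ
  rw [← inner_fderiv_gradient hΦ] at h1
  have h2 := real_inner_le_norm (fderiv ℝ (gradient Φ) z ξ) ξ
  have h3 : 0 < ‖ξ‖ := norm_pos_iff.2 hξ
  refine le_of_mul_le_mul_right ?_ h3
  nlinarith

/-- The chain rule for `s ↦ -s` shows that the derivative at `0` equals its own negative. -/
theorem fderiv_apply_eq_zero_of_even {Φ : E → ℝ} (hΦ : ContDiff ℝ 2 Φ) (a ξ : E)
    (h : ∀ s : ℝ, Φ (a + (-s) • ξ) = Φ (a + s • ξ)) : fderiv ℝ Φ a ξ = 0 := by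
  have h1 : HasDerivAt (fun s : ℝ => Φ (a + s • ξ)) (fderiv ℝ Φ a ξ) 0 := by
    simpa using hasDerivAt_line hΦ a ξ 0
  have h1' : HasDerivAt (fun s : ℝ => Φ (a + s • ξ)) (fderiv ℝ Φ a ξ) (-0) := by
    rwa [neg_zero]
  have h2 := h1'.comp (0 : ℝ) (hasDerivAt_neg (0 : ℝ))
  have h3 : ((fun s : ℝ => Φ (a + s • ξ)) ∘ Neg.neg) = fun s : ℝ => Φ (a + s • ξ) := by
    funext s
    simpa using h s
  rw [h3] at h2
  have := h2.unique h1
  linarith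

/-- The gradient of a radial function is radial. -/
theorem norm_gradient_of_radial [CompleteSpace E] {Φ : E → ℝ} (hΦ : ContDiff ℝ 2 Φ) {φ : ℝ → ℝ}
    (hφ : ∀ z, Φ z = φ ‖z‖) {e : E} (he : ‖e‖ = 1) (r : ℝ) :
    ‖gradient Φ (r • e)‖ = |fderiv ℝ Φ (r • e) e| := by
  set g := gradient Φ (r • e)
  set η := g - (inner ℝ g e : ℝ) • e
  have hee : inner ℝ e e = (1 : ℝ) := by rw [real_inner_self_eq_norm_sq, he]; norm_num
  have hη : inner ℝ e η = (0 : ℝ) := by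
    rw [inner_sub_right, inner_smul_right, hee, real_inner_comm]; ring
  have h1 : inner ℝ g η = (0 : ℝ) := by
    rw [inner_gradient_left]
    -- Since `η ⟂ e`, the norm of `r e + s η` is even in `s`; hence the part `η` of the gradient
    -- orthogonal to `e` is orthogonal to the gradient, and so vanishes.
    apply fderiv_apply_eq_zero_of_even hΦ
    intro s
    rw [hφ, hφ]
    congr 1
    rw [← sq_eq_sq₀ (norm_nonneg _) (norm_nonneg _), norm_add_sq_real, norm_add_sq_real]
    simp [inner_smul_left, inner_smul_right, hη, norm_smul]
  have h2 : inner ℝ η η = (0 : ℝ) := by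
    rw [show inner ℝ η η = inner ℝ g η - inner ℝ ((inner ℝ g e : ℝ) • e) η from
      inner_sub_left _ _ _, h1, inner_smul_left, hη]
    simp
  have h3 : η = 0 := inner_self_eq_zero.1 h2
  have h4 : g = (inner ℝ g e : ℝ) • e := sub_eq_zero.1 h3
  have h5 : inner ℝ g e = fderiv ℝ Φ (r • e) e := inner_gradient_left
  rw [h4, norm_smul, he, mul_one, h5, Real.norm_eq_abs]

end Calculus

/-! ### Construction of `γ` -/

section Profile

/-- For a uniformly convex even profile `p` there is a `C¹` increasing `γ` with
`γ (p r) = p' r ^ 2 / 2` for `r ≥ 0`; namely `γ' = p'' ∘ p⁻¹`. -/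
theorem exists_gamma_of_profile {p p' p'' : ℝ → ℝ} {lam : ℝ} (hlam : 0 < lam)
    (hp : ∀ r, HasDerivAt p (p' r) r) (hp' : ∀ r, HasDerivAt p' (p'' r) r)
    (hc : Continuous p'') (hlow : ∀ r, lam ≤ p'' r) (h0 : p' 0 = 0) :
    ∃ γ : ℝ → ℝ, ContDiff ℝ 1 γ ∧ StrictMono γ ∧ ∀ r, 0 ≤ r → γ (p r) = 1 / 2 * p' r ^ 2 := by
  have hp'low : ∀ r, 0 ≤ r → lam * r ≤ p' r := by
    intro r hr
    have := mul_sub_le_image_sub_of_le_deriv (f := p') (C := lam)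
      (fun r => (hp' r).differentiableAt) (fun r => by rw [(hp' r).deriv]; exact hlow r) hr
    simpa [h0] using this
  have hplow : ∀ r, 0 ≤ r → p 0 + lam / 2 * r ^ 2 ≤ p r := by
    intro r hr
    have hd : ∀ x, HasDerivAt (fun x => p x - lam / 2 * x ^ 2) (p' x - lam * x) x := by
      intro x
      have := (hp x).sub (((hasDerivAt_pow 2 x)).const_mul (lam / 2))
      refine HasDerivAt.congr_deriv this ?_
      norm_num; ring
    have hm : MonotoneOn (fun x => p x - lam / 2 * x ^ 2) (Ici 0) := by
      apply monotoneOn_of_deriv_nonneg (convex_Ici 0)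
      · exact fun x _ => (hd x).continuousAt.continuousWithinAt
      · exact fun x _ => (hd x).differentiableAt.differentiableWithinAt
      · intro x hx
        rw [interior_Ici] at hx
        rw [(hd x).deriv]
        linarith [hp'low x (le_of_lt hx)]
    have := hm (mem_Ici.2 le_rfl) (mem_Ici.2 hr) hr
    simp at this
    linarith
  have hpc : Continuous p := continuous_iff_continuousAt.2 fun r => (hp r).continuousAt
  have hps : StrictMonoOn p (Ici 0) := by
    apply strictMonoOn_of_deriv_pos (convex_Ici 0) hpc.continuousOn
    intro x hx
    rw [interior_Ici] at hx
    rw [(hp x).deriv]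
    exact lt_of_lt_of_le (mul_pos hlam hx) (hp'low x (le_of_lt hx))
  -- `p` is even in the application, so only its restriction to `[0, ∞)` can be inverted. Extending
  -- that restriction with slope one to the left gives an increasing bijection of `ℝ`, whose inverse
  -- is continuous everywhere.
  let q : ℝ → ℝ := fun r => p (max r 0) + min r 0
  have hqc : Continuous q := by fun_prop
  have hqs : StrictMono q := by
    intro a b hab
    rcases lt_or_ge a 0 with ha | ha
    · have h1 : p (max a 0) ≤ p (max b 0) :=
        hps.monotoneOn (mem_Ici.2 (le_max_right _ _)) (mem_Ici.2 (le_max_right _ _))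
          (max_le_max hab.le le_rfl)
      have h2 : min a 0 < min b 0 := by
        rw [min_eq_left ha.le]
        exact lt_min hab ha
      exact add_lt_add_of_le_of_lt h1 h2
    · have hb : 0 ≤ b := ha.trans hab.le
      simp only [q, max_eq_left ha, max_eq_left hb, min_eq_right ha, min_eq_right hb, add_zero]
      exact hps (mem_Ici.2 ha) (mem_Ici.2 hb) hab
  have hqt : Tendsto q atTop atTop := by
    have ht : Tendsto (fun r : ℝ => p 0 + lam / 2 * r ^ 2) atTop atTop :=
      tendsto_atTop_add_const_left _ _
        ((tendsto_pow_atTop (by norm_num)).const_mul_atTop (by positivity))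
    refine tendsto_atTop_mono' _ ?_ ht
    filter_upwards [eventually_ge_atTop 0] with r hr
    simp only [q, max_eq_left hr, min_eq_right hr, add_zero]
    exact hplow r hr
  have hqb : Tendsto q atBot atBot := by
    have ht : Tendsto (fun r : ℝ => p 0 + r) atBot atBot :=
      tendsto_atBot_add_const_left _ _ tendsto_id
    refine ht.congr' ?_
    filter_upwards [eventually_le_atBot 0] with r hr
    simp only [q, max_eq_right hr, min_eq_left hr]
  let Q : ℝ ≃o ℝ := hqs.orderIsoOfSurjective q (hqc.surjective hqt hqb)
  have hQc : Continuous Q.symm := Q.symm.toHomeomorph.continuous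
  have hQ : ∀ r, 0 ≤ r → Q.symm (p r) = r := by
    intro r hr
    have : Q r = p r := by
      change q r = p r
      simp only [q, max_eq_left hr, min_eq_right hr, add_zero]
    rw [← this, OrderIso.symm_apply_apply]
  -- This is `p'' ∘ p⁻¹` above `p 0` and the constant `p'' 0` below it, so `γ` is increasing on all
  -- of `ℝ`.
  let d : ℝ → ℝ := fun y => p'' (max (Q.symm y) 0)
  have hdc : Continuous d := by fun_prop
  let γ : ℝ → ℝ := fun y => ∫ s in (p 0)..y, d s
  have hγ : ∀ y, HasDerivAt γ (d y) y := fun y =>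
    intervalIntegral.integral_hasDerivAt_right (hdc.intervalIntegrable _ _)
      (hdc.stronglyMeasurableAtFilter _ _) hdc.continuousAt
  have hγd : deriv γ = d := funext fun y => (hγ y).deriv
  refine ⟨γ, ?_, ?_, ?_⟩
  · rw [contDiff_one_iff_deriv]
    exact ⟨fun y => (hγ y).differentiableAt, by rw [hγd]; exact hdc⟩
  · apply strictMono_of_deriv_pos
    intro y
    rw [hγd]
    exact hlam.trans_le (hlow _)
  · intro r hr
    rcases hr.eq_or_lt with rfl | hr
    · simp [γ, h0]
    -- On `[0, r]` one has `d (p x) = p'' x`, so this difference is constant; it vanishes at `0`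
    -- because `γ` is based at `p 0` and `p' 0 = 0`.
    have hD : ∀ x, HasDerivAt (fun x => γ (p x) - 1 / 2 * p' x ^ 2)
        (d (p x) * p' x - p' x * p'' x) x := by
      intro x
      have := ((hγ (p x)).comp x (hp x)).sub (((hp' x).pow 2).const_mul (1 / 2))
      refine HasDerivAt.congr_deriv this ?_
      norm_num; ring
    have := constant_of_derivWithin_zero (f := fun x => γ (p x) - 1 / 2 * p' x ^ 2) (a := 0) (b := r)
      (fun x _ => (hD x).differentiableAt.differentiableWithinAt) (by
        intro x hx
        rw [(hD x).hasDerivWithinAt.derivWithin (uniqueDiffOn_Icc hr x ⟨hx.1, hx.2.le⟩)]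
        simp only [d, hQ x hx.1, max_eq_left hx.1]
        ring) r ⟨hr.le, le_rfl⟩
    simp only [γ, intervalIntegral.integral_same, h0] at this
    simp only [γ]
    linarith

end Profile

/-- The profile `r ↦ Φ (r e)` along a unit vector extends `φ` evenly to negative `r`, so it has
two-sided derivatives at `0`. The last conclusion is the one used in the analysis: it replaces
`γ(φ(|u|))` by the `C¹` function `½|∇Φ|²` of `u`. -/
theorem exists_gamma {N : ℕ} (hN : 1 ≤ N) {Φ : EuclideanSpace ℝ (Fin N) → ℝ} {lam Lam : ℝ}
    (hΦ : IsUniformlyConvex Φ lam Lam) {φ : ℝ → ℝ} (hφ : ∀ z, Φ z = φ ‖z‖) :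
    ∃ γ : ℝ → ℝ, ContDiff ℝ 1 γ ∧ StrictMono γ ∧
      (∀ z : ℝ, 0 ≤ z → γ (φ z) = 1 / 2 * (derivWithin φ (Set.Ici 0) z) ^ 2) ∧
      ∀ z, γ (φ ‖z‖) = 1 / 2 * ‖gradient Φ z‖ ^ 2 := by
  obtain ⟨hlam, hC, hH⟩ := hΦ
  let e : EuclideanSpace ℝ (Fin N) := EuclideanSpace.single ⟨0, hN⟩ 1
  have he : ‖e‖ = 1 := by simp [e]
  have hp : ∀ r : ℝ, HasDerivAt (fun r : ℝ => Φ (r • e)) (fderiv ℝ Φ (r • e) e) r := by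
    intro r
    simpa using hasDerivAt_line hC 0 e r
  have hp' : ∀ r : ℝ, HasDerivAt (fun r : ℝ => fderiv ℝ Φ (r • e) e)
      (fderiv ℝ (fderiv ℝ Φ) (r • e) e e) r := by
    intro r
    simpa using hasDerivAt_fderiv_line hC 0 e r
  have hC1 : ContDiff ℝ 1 (fderiv ℝ Φ) := hC.fderiv_right (by norm_num)
  have hC0 : Continuous (fderiv ℝ (fderiv ℝ Φ)) := hC1.continuous_fderiv (by norm_num)
  have h0 : fderiv ℝ Φ ((0 : ℝ) • e) e = 0 := by
    apply fderiv_apply_eq_zero_of_even hC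
    intro s
    simp [hφ, norm_smul]
  have hpφ : ∀ r : ℝ, 0 ≤ r → Φ (r • e) = φ r := by
    intro r hr
    rw [hφ, norm_smul, he, Real.norm_of_nonneg hr, mul_one]
  obtain ⟨γ, h1, h2, h3⟩ := exists_gamma_of_profile hlam hp hp' (by fun_prop) (fun r => by
    have := (hH (r • e) e).1
    rw [iteratedFDeriv_two_apply] at this
    simpa [he] using this) h0
  refine ⟨γ, h1, h2, ?_, ?_⟩
  · intro z hz
    have hd : HasDerivWithinAt φ (fderiv ℝ Φ (z • e) e) (Ici 0) z :=
      (hp z).hasDerivWithinAt.congr (fun r hr => (hpφ r hr).symm) (hpφ z hz).symm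
    rw [hd.derivWithin (uniqueDiffOn_Ici 0 z hz), ← h3 z hz, hpφ z hz]
  · intro z
    rcases eq_or_ne z 0 with rfl | hz
    · have h5 := norm_gradient_of_radial hC hφ he 0
      rw [h0, zero_smul] at h5
      have h4 := h3 0 le_rfl
      rw [hpφ 0 le_rfl, h0] at h4
      rw [norm_zero, h4, h5, abs_zero]
    · have hz' : 0 < ‖z‖ := norm_pos_iff.2 hz
      have hu : ‖(‖z‖⁻¹ • z)‖ = 1 := by
        rw [norm_smul, norm_inv, norm_norm, inv_mul_cancel₀ hz'.ne']
      have h5 := norm_gradient_of_radial hC hφ hu ‖z‖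
      rw [smul_inv_smul₀ hz'.ne'] at h5
      -- The profiles along the direction of `z` and along `e` are the same function, hence have the
      -- same derivative at `‖z‖`.
      have h6 : fderiv ℝ Φ z (‖z‖⁻¹ • z) = fderiv ℝ Φ (‖z‖ • e) e := by
        have h7 : HasDerivAt (fun r : ℝ => Φ (r • (‖z‖⁻¹ • z))) (fderiv ℝ Φ z (‖z‖⁻¹ • z)) ‖z‖ := by
          have := hasDerivAt_line hC 0 (‖z‖⁻¹ • z) ‖z‖
          simpa only [zero_add, smul_inv_smul₀ hz'.ne'] using this
        refine h7.unique ?_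
        have h8 : (fun r : ℝ => Φ (r • (‖z‖⁻¹ • z))) = fun r : ℝ => Φ (r • e) := by
          funext r
          rw [hφ, hφ, norm_smul r, norm_smul r, hu, he]
        rw [h8]
        exact hp ‖z‖
      rw [h5, h6, sq_abs, ← h3 _ hz'.le, hpφ _ hz'.le]

/-! ### Convergence and pairings in `L²` -/

section LTwo

variable {α : Type*} [MeasurableSpace α] {μ : Measure α}
variable {E F G W : Type*} [NormedAddCommGroup E] [NormedAddCommGroup F] [NormedAddCommGroup G]
  [NormedAddCommGroup W]

theorem eLpNorm_two_sq (f : α → F) : eLpNorm f 2 μ ^ 2 = ∫⁻ x, ‖f x‖ₑ ^ 2 ∂μ := by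
  have := eLpNorm_nnreal_pow_eq_lintegral (μ := μ) (f := f) (p := 2) (by norm_num)
  norm_num at this
  exact this

theorem tendsto_eLpNorm_two_iff {ι : Type*} {l : Filter ι} {f : ι → α → F} :
    Tendsto (fun k => eLpNorm (f k) 2 μ) l (𝓝 0) ↔
      Tendsto (fun k => ∫⁻ x, ‖f k x‖ₑ ^ 2 ∂μ) l (𝓝 0) := by
  simp only [← eLpNorm_two_sq]
  constructor
  · intro h
    simpa using ENNReal.Tendsto.pow (n := 2) h
  · intro h
    have h2 := (ENNReal.continuous_rpow_const (y := 1 / 2)).tendsto _ |>.comp h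
    refine (h2.congr fun k => ?_).trans (by simp)
    simp only [Function.comp_apply]
    rw [← ENNReal.rpow_natCast, ← ENNReal.rpow_mul]
    norm_num

theorem memLp_two_iff {f : α → F} (hf : AEStronglyMeasurable f μ) :
    MemLp f 2 μ ↔ ∫⁻ x, ‖f x‖ₑ ^ 2 ∂μ < ⊤ := by
  rw [← eLpNorm_two_sq, MemLp]
  simp [hf, lt_top_iff_ne_top]

/-- Dominated convergence in `L²`. -/
theorem tendsto_eLpNorm_two_of_dominated {f : ℕ → α → F} {f₀ : α → F} {b : α → ℝ}
    (hb : MemLp b 2 μ) (hf : ∀ k, AEStronglyMeasurable (f k) μ)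
    (hfb : ∀ k, ∀ᵐ x ∂μ, ‖f k x‖ ≤ b x)
    (hlim : ∀ᵐ x ∂μ, Tendsto (fun k => f k x) atTop (𝓝 (f₀ x))) :
    Tendsto (fun k => eLpNorm (fun x => f k x - f₀ x) 2 μ) atTop (𝓝 0) := by
  have hf₀ : AEStronglyMeasurable f₀ μ := aestronglyMeasurable_of_tendsto_ae _ hf hlim
  rw [tendsto_eLpNorm_two_iff]
  have h0 : ∀ᵐ x ∂μ, ‖f₀ x‖ ≤ b x := by
    filter_upwards [ae_all_iff.2 hfb, hlim] with x hx hx'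
    exact le_of_tendsto hx'.norm (Eventually.of_forall hx)
  have hb2 : MemLp (fun x => 2 * b x) 2 μ := hb.const_mul 2
  have := tendsto_lintegral_of_dominated_convergence' (μ := μ)
    (F := fun k x => ‖f k x - f₀ x‖ₑ ^ 2) (f := fun _ => 0) (fun x => ‖2 * b x‖ₑ ^ 2)
    (fun k => ((hf k).sub hf₀).enorm.pow_const 2) ?_ ?_ ?_
  · simpa using this
  · intro k
    filter_upwards [hfb k, h0] with x h1 h2
    gcongr
    refine enorm_le_iff_norm_le.2 ?_
    refine (norm_sub_le _ _).trans (le_trans ?_ (le_abs_self _))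
    linarith
  · exact ((memLp_two_iff hb2.1).1 hb2).ne
  · filter_upwards [hlim] with x hx
    have : Tendsto (fun k => f k x - f₀ x) atTop (𝓝 0) := by
      simpa using hx.sub_const (f₀ x)
    simpa using ENNReal.Tendsto.pow (n := 2) this.enorm

theorem memLp_of_tendsto_eLpNorm {ι : Type*} {l : Filter ι} [l.NeBot] {f : ι → α → F} {f₀ : α → F}
    (hf : ∀ k, MemLp (f k) 2 μ) (hf₀ : AEStronglyMeasurable f₀ μ)
    (h : Tendsto (fun k => eLpNorm (fun x => f k x - f₀ x) 2 μ) l (𝓝 0)) : MemLp f₀ 2 μ := by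
  obtain ⟨k, hk⟩ := (h.eventually_lt_const ENNReal.zero_lt_top).exists
  have h1 : MemLp (fun x => f k x - f₀ x) 2 μ := ⟨(hf k).1.sub hf₀, hk⟩
  have h2 := (hf k).sub h1
  refine h2.congr_norm hf₀ (ae_of_all _ fun x => ?_)
  simp

theorem tendsto_eLpNorm_add {ι : Type*} {l : Filter ι} {f g : ι → α → F}
    (hfm : ∀ k, AEStronglyMeasurable (f k) μ) (hgm : ∀ k, AEStronglyMeasurable (g k) μ)
    (hf : Tendsto (fun k => eLpNorm (f k) 2 μ) l (𝓝 0))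
    (hg : Tendsto (fun k => eLpNorm (g k) 2 μ) l (𝓝 0)) :
    Tendsto (fun k => eLpNorm (fun x => f k x + g k x) 2 μ) l (𝓝 0) := by
  refine tendsto_of_tendsto_of_tendsto_of_le_of_le tendsto_const_nhds
    (by simpa using hf.add hg) (fun _ => zero_le) (fun k => ?_)
  exact eLpNorm_add_le (hfm k) (hgm k) (by norm_num)

theorem tendsto_eLpNorm_of_le_mul {ι : Type*} {l : Filter ι} {f : ι → α → F} {g : ι → α → G}
    {C : ℝ} (h : ∀ k, ∀ᵐ x ∂μ, ‖f k x‖ ≤ C * ‖g k x‖)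
    (hg : Tendsto (fun k => eLpNorm (g k) 2 μ) l (𝓝 0)) :
    Tendsto (fun k => eLpNorm (f k) 2 μ) l (𝓝 0) := by
  refine tendsto_of_tendsto_of_tendsto_of_le_of_le tendsto_const_nhds
    (by simpa using ENNReal.Tendsto.const_mul (a := ENNReal.ofReal C) hg (by simp))
    (fun _ => zero_le) (fun k => ?_)
  exact eLpNorm_le_mul_eLpNorm_of_ae_le_mul (h k) 2

variable [NormedSpace ℝ E] [NormedSpace ℝ F] [NormedSpace ℝ G] [NormedSpace ℝ W]

/-- Bounded a.e. convergent operators applied to an `L²`-convergent sequence. -/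
theorem tendsto_eLpNorm_clm_apply {A : ℕ → α → F →L[ℝ] G} {A₀ : α → F →L[ℝ] G}
    {g : ℕ → α → F} {g₀ : α → F} {C : ℝ}
    (hA : ∀ k, AEStronglyMeasurable (A k) μ) (hAC : ∀ k, ∀ᵐ x ∂μ, ‖A k x‖ ≤ C)
    (hlim : ∀ᵐ x ∂μ, Tendsto (fun k => A k x) atTop (𝓝 (A₀ x)))
    (hg : ∀ k, AEStronglyMeasurable (g k) μ) (hg₀ : MemLp g₀ 2 μ)
    (hgl : Tendsto (fun k => eLpNorm (fun x => g k x - g₀ x) 2 μ) atTop (𝓝 0)) :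
    Tendsto (fun k => eLpNorm (fun x => A k x (g k x) - A₀ x (g₀ x)) 2 μ) atTop (𝓝 0) := by
  have hA₀ : AEStronglyMeasurable A₀ μ := aestronglyMeasurable_of_tendsto_ae _ hA hlim
  have happ : ∀ {B : α → F →L[ℝ] G} {f : α → F}, AEStronglyMeasurable B μ →
      AEStronglyMeasurable f μ → AEStronglyMeasurable (fun x => B x (f x)) μ :=
    fun hB hf => isBoundedBilinearMap_apply.continuous.comp_aestronglyMeasurable₂ hB hf
  -- Split `A k (g k) - A₀ g₀` as `A k (g k - g₀) + (A k - A₀) g₀`: the first term is small by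
  -- boundedness of `A k`, the second by dominated convergence.
  have h1 : Tendsto (fun k => eLpNorm (fun x => A k x (g k x - g₀ x)) 2 μ) atTop (𝓝 0) := by
    refine tendsto_eLpNorm_of_le_mul (C := C) (fun k => ?_) hgl
    filter_upwards [hAC k] with x hx
    exact (A k x).le_of_opNorm_le hx _
  have h2 : Tendsto (fun k => eLpNorm (fun x => A k x (g₀ x) - A₀ x (g₀ x)) 2 μ) atTop (𝓝 0) := by
    refine tendsto_eLpNorm_two_of_dominated (b := fun x => C * ‖g₀ x‖) (hg₀.norm.const_mul C)
      (fun k => happ (hA k) hg₀.1) (fun k => ?_) ?_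
    · filter_upwards [hAC k] with x hx
      exact (A k x).le_of_opNorm_le hx _
    · filter_upwards [hlim] with x hx
      exact ((ContinuousLinearMap.apply ℝ G (g₀ x)).continuous.tendsto _).comp hx
  have h3 := tendsto_eLpNorm_add (fun k => happ (hA k) ((hg k).sub hg₀.1))
    (fun k => (happ (hA k) hg₀.1).sub (happ hA₀ hg₀.1)) h1 h2
  refine h3.congr fun k => ?_
  congr 1
  funext x
  simp

theorem integrable_bilin (B : E →L[ℝ] F →L[ℝ] W) {f : α → E} {g : α → F}
    (hf : MemLp f 2 μ) (hg : MemLp g 2 μ) : Integrable (fun x => B (f x) (g x)) μ := by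
  rw [← memLp_one_iff_integrable]
  refine MemLp.of_bilin (fun a b => B a b) ‖B‖₊ hf hg
    (B.aestronglyMeasurable_comp₂ hf.1 hg.1) (ae_of_all _ fun x => ?_)
  exact B.le_opNorm₂ _ _

/-- Pairing with a fixed `L²` function is continuous along `L²` convergence. -/
theorem tendsto_integral_bilin {ι : Type*} {l : Filter ι} (B : E →L[ℝ] F →L[ℝ] W) {f : α → E}
    {g : ι → α → F} {g₀ : α → F} (hf : MemLp f 2 μ) (hg : ∀ k, MemLp (g k) 2 μ)
    (hg₀ : MemLp g₀ 2 μ)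
    (hgl : Tendsto (fun k => eLpNorm (fun x => g k x - g₀ x) 2 μ) l (𝓝 0)) :
    Tendsto (fun k => ∫ x, B (f x) (g k x) ∂μ) l (𝓝 (∫ x, B (f x) (g₀ x) ∂μ)) := by
  refine tendsto_integral_of_L1' _ (integrable_bilin B hf hg₀).1
    (Eventually.of_forall fun k => integrable_bilin B hf (hg k)) ?_
  have h1 : Tendsto (fun k => ‖B‖₊ * eLpNorm f 2 μ * eLpNorm (fun x => g k x - g₀ x) 2 μ) l
      (𝓝 0) := by
    have := ENNReal.Tendsto.const_mul (a := ‖B‖₊ * eLpNorm f 2 μ) hgl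
      (Or.inr (ENNReal.mul_ne_top ENNReal.coe_ne_top hf.2.ne))
    simpa using this
  refine tendsto_of_tendsto_of_tendsto_of_le_of_le tendsto_const_nhds h1 (fun _ => zero_le)
    (fun k => ?_)
  have h2 := eLpNorm_le_eLpNorm_mul_eLpNorm_of_nnnorm (p := 2) (q := 2) (r := 1) hf.1
    ((hg k).1.sub hg₀.1) (fun a b => B a b) ‖B‖₊ (ae_of_all _ fun x => B.le_opNorm₂ _ _)
  refine le_trans (le_of_eq ?_) h2
  congr 1
  funext x
  simp

end LTwo

instance instIsAddHaarMeasureSpaceTime (n : ℕ) :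
    (volume : Measure (SpaceTime n)).IsAddHaarMeasure :=
  Measure.prod.instIsAddHaarMeasure _ _

/-! ### Translations in `L²` -/

section Translation

variable {n : ℕ} {F : Type*} [NormedAddCommGroup F]

theorem measurePreserving_add_smul (e : SpaceTime n) (s : ℝ) :
    MeasurePreserving (fun p : SpaceTime n => p + s • e) volume volume :=
  measurePreserving_add_right volume (s • e)

/-- Translations act continuously on `L²`. -/
theorem tendsto_eLpNorm_translate {f : SpaceTime n → F} (hf : MemLp f 2 volume)
    (e : SpaceTime n) :
    Tendsto (fun s : ℝ => eLpNorm (fun p => f (p + s • e) - f p) 2 volume) (𝓝 0) (𝓝 0) := by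
  -- Currying gives continuity of `s ↦ (· + s e)` in the compact-open topology, the form required
  -- for composition with measure preserving maps to be continuous in `Lp`.
  let g : ℝ → C(SpaceTime n, SpaceTime n) :=
    (ContinuousMap.mk (fun q : ℝ × SpaceTime n => q.2 + q.1 • e) (by fun_prop)).curry
  have hg : Continuous g := ContinuousMap.continuous _
  have hm : ∀ s, MeasurePreserving (g s) volume volume := fun s =>
    measurePreserving_add_smul e s
  have h := Filter.Tendsto.compMeasurePreservingLp (l := 𝓝 (0 : ℝ)) (p := 2)
    (f := fun _ => hf.toLp f) (f₀ := hf.toLp f) tendsto_const_nhds (hg.tendsto 0) hm (hm 0)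
    (by norm_num)
  rw [Lp.tendsto_Lp_iff_tendsto_eLpNorm'] at h
  refine h.congr fun s => eLpNorm_congr_ae ?_
  have h1 := Lp.coeFn_compMeasurePreserving (hf.toLp f) (hm s)
  have h2 := Lp.coeFn_compMeasurePreserving (hf.toLp f) (hm 0)
  have h3 := (hm s).quasiMeasurePreserving.ae_eq_comp hf.coeFn_toLp
  have h4 := (hm 0).quasiMeasurePreserving.ae_eq_comp hf.coeFn_toLp
  filter_upwards [h1, h2, h3, h4] with p h1 h2 h3 h4
  rw [Pi.sub_apply, h1, h2, h3, h4]
  simp [g]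

end Translation

/-! ### Weak derivatives and the chain rule -/

section WeakDeriv

theorem locallyIntegrableOn_of_memLp {n : ℕ} {F : Type*} [NormedAddCommGroup F]
    {O : Set (SpaceTime n)} {f : SpaceTime n → F} {q : ENNReal} (hq : 1 ≤ q)
    (hf : MemLp f q (volume.restrict O)) : LocallyIntegrableOn f O volume :=
  locallyIntegrableOn_of_locallyIntegrable_restrict (hf.locallyIntegrable hq)

variable {n : ℕ} {F G : Type*} [NormedAddCommGroup F] [NormedSpace ℝ F] [NormedAddCommGroup G]
  [NormedSpace ℝ G] {O : Set (SpaceTime n)}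

theorem integrable_smul_of_tsupport_subset {ψ : SpaceTime n → ℝ} {g : SpaceTime n → F}
    (hψ : Continuous ψ) (hc : HasCompactSupport ψ) (hs : tsupport ψ ⊆ O)
    (hg : LocallyIntegrableOn g O volume) : Integrable (fun p => ψ p • g p) volume := by
  have h1 : IntegrableOn (fun p => ψ p • g p) (tsupport ψ) volume :=
    (hg.integrableOn_compact_subset hs hc).continuousOn_smul hψ.continuousOn hc
  rw [integrableOn_iff_integrable_of_support_subset] at h1
  · exact h1
  · intro p hp
    apply subset_tsupport
    intro h
    exact hp (by simp [h])

theorem IsTestFunction.continuous_fderiv_apply {ψ : SpaceTime n → F} (hψ : IsTestFunction O ψ)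
    (e : SpaceTime n) : Continuous fun p => fderiv ℝ ψ p e :=
  (hψ.1.continuous_fderiv (by simp)).clm_apply continuous_const

theorem tsupport_fderiv_apply_subset_tsupport {ψ : SpaceTime n → F} (e : SpaceTime n) :
    tsupport (fun p => fderiv ℝ ψ p e) ⊆ tsupport ψ :=
  tsupport_fderiv_apply_subset ℝ e

theorem hasCompactSupport_fderiv_apply {ψ : SpaceTime n → F} (hc : HasCompactSupport ψ)
    (e : SpaceTime n) : HasCompactSupport fun p => fderiv ℝ ψ p e :=
  hc.fderiv_apply ℝ e

theorem setIntegral_eq_integral_of_tsupport {ψ : SpaceTime n → ℝ} (hs : tsupport ψ ⊆ O)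
    (g : SpaceTime n → F) : ∫ p in O, ψ p • g p = ∫ p, ψ p • g p := by
  apply setIntegral_eq_integral_of_forall_compl_eq_zero
  intro p hp
  rw [image_eq_zero_of_notMem_tsupport fun h => hp (hs h), zero_smul]

/-- Weak derivatives are unique. -/
theorem HasWeakDeriv.ae_eq [CompleteSpace F] (hO : IsOpen O) {e : SpaceTime n}
    {f g g' : SpaceTime n → F} (h : HasWeakDeriv O e f g) (h' : HasWeakDeriv O e f g') :
    g =ᵐ[volume.restrict O] g' := by
  have h1 := IsOpen.ae_eq_zero_of_integral_contDiff_smul_eq_zero hO (f := fun p => g p - g' p)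
    (h.2.1.sub h'.2.1) (fun ψ hψ hc hs => by
      have e1 := h.2.2 ψ ⟨hψ, hc, hs⟩
      have e2 := h'.2.2 ψ ⟨hψ, hc, hs⟩
      rw [e1, setIntegral_eq_integral_of_tsupport hs, setIntegral_eq_integral_of_tsupport hs] at e2
      simp only [smul_sub]
      rw [integral_sub (integrable_smul_of_tsupport_subset hψ.continuous hc hs h.2.1)
        (integrable_smul_of_tsupport_subset hψ.continuous hc hs h'.2.1), neg_injective e2, sub_self])
  rw [EventuallyEq, ae_restrict_iff' hO.measurableSet]
  filter_upwards [h1] with p hp hpO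
  exact sub_eq_zero.1 (hp hpO)

/-- Integration by parts against the constant `1`. -/
theorem integral_fderiv_apply_eq_zero [CompleteSpace F] {f : SpaceTime n → F}
    (hf : ContDiff ℝ 1 f) (hc : HasCompactSupport f) (e : SpaceTime n) :
    ∫ p, fderiv ℝ f p e = 0 := by
  have hd : Continuous fun p => fderiv ℝ f p e :=
    (hf.continuous_fderiv (by norm_num)).clm_apply continuous_const
  have := integral_smul_fderiv_eq_neg_fderiv_smul_of_integrable (𝕜 := ℝ)
    (μ := (volume : Measure (SpaceTime n))) (f := fun _ => 1) (g := f) (v := e)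
    (by simp) (by simpa using hd.integrable_of_hasCompactSupport (hasCompactSupport_fderiv_apply hc e))
    (by simpa using hf.continuous.integrable_of_hasCompactSupport hc)
    (fun _ _ => differentiableAt_const _) (fun _ _ => hf.differentiable (by norm_num) _)
  simpa using this

theorem contDiff_smul_of_tsupport_subset (hO : IsOpen O) {ψ : SpaceTime n → ℝ}
    {U : SpaceTime n → F} (hψ : ContDiff ℝ 1 ψ) (hs : tsupport ψ ⊆ O) (hU : ContDiffOn ℝ 1 U O) :
    ContDiff ℝ 1 fun p => ψ p • U p := by
  rw [contDiff_iff_contDiffAt]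
  intro p
  by_cases hp : p ∈ tsupport ψ
  · exact hψ.contDiffAt.smul (hU.contDiffAt (hO.mem_nhds (hs hp)))
  · have h0 : (fun p => ψ p • U p) =ᶠ[𝓝 p] fun _ => 0 := by
      filter_upwards [notMem_tsupport_iff_eventuallyEq.1 hp] with q hq
      rw [hq]
      simp
    exact contDiffAt_const.congr_of_eventuallyEq h0

/-- The product rule holds at every point, even where `U` is not differentiable: off `tsupport ψ`
the product vanishes nearby, and on the right both `ψ` and its derivative are zero. -/
theorem fderiv_smul_apply_of_tsupport_subset (hO : IsOpen O) {ψ : SpaceTime n → ℝ}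
    {U : SpaceTime n → F} (hψ : ContDiff ℝ 1 ψ) (hs : tsupport ψ ⊆ O) (hU : ContDiffOn ℝ 1 U O)
    (p e : SpaceTime n) :
    fderiv ℝ (fun p => ψ p • U p) p e = fderiv ℝ ψ p e • U p + ψ p • fderiv ℝ U p e := by
  by_cases hp : p ∈ tsupport ψ
  · have h1 := (hU.differentiableOn (by norm_num)).differentiableAt (hO.mem_nhds (hs hp))
    rw [fderiv_fun_smul (hψ.differentiable (by norm_num) p) h1]
    simp [add_comm]
  · have h0 : (fun p => ψ p • U p) =ᶠ[𝓝 p] fun _ => 0 := by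
      filter_upwards [notMem_tsupport_iff_eventuallyEq.1 hp] with q hq
      rw [hq]
      simp
    rw [h0.fderiv_eq, (notMem_tsupport_iff_eventuallyEq.1 hp).fderiv_eq,
      image_eq_zero_of_notMem_tsupport hp]
    simp [Pi.zero_def]

theorem continuousOn_fderiv_apply (hO : IsOpen O) {U : SpaceTime n → F}
    (hU : ContDiffOn ℝ 1 U O) (e : SpaceTime n) : ContinuousOn (fun p => fderiv ℝ U p e) O :=
  (hU.continuousOn_fderiv_of_isOpen hO (by norm_num)).clm_apply continuousOn_const

/-- Classical derivatives are weak derivatives. -/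
theorem HasWeakDeriv.of_contDiffOn [CompleteSpace F] (hO : IsOpen O) {U : SpaceTime n → F}
    (hU : ContDiffOn ℝ 1 U O) (e : SpaceTime n) :
    HasWeakDeriv O e U fun p => fderiv ℝ U p e := by
  have h1 : LocallyIntegrableOn U O volume :=
    hU.continuousOn.locallyIntegrableOn hO.measurableSet
  have h2 : LocallyIntegrableOn (fun p => fderiv ℝ U p e) O volume :=
    (continuousOn_fderiv_apply hO hU e).locallyIntegrableOn hO.measurableSet
  refine ⟨h1, h2, fun ψ hψ => ?_⟩
  have hψ1 : ContDiff ℝ 1 ψ := hψ.1.of_le (by simp)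
  have hs' : tsupport (fun p => fderiv ℝ ψ p e) ⊆ O :=
    (tsupport_fderiv_apply_subset_tsupport e).trans hψ.2.2
  have h0 := integral_fderiv_apply_eq_zero
    (contDiff_smul_of_tsupport_subset hO hψ1 hψ.2.2 hU) (hψ.2.1.smul_right (f' := U)) e
  simp only [fderiv_smul_apply_of_tsupport_subset hO hψ1 hψ.2.2 hU] at h0
  rw [integral_add (integrable_smul_of_tsupport_subset (hψ.continuous_fderiv_apply e)
      (hasCompactSupport_fderiv_apply hψ.2.1 e) hs' h1)
    (integrable_smul_of_tsupport_subset hψ.1.continuous hψ.2.1 hψ.2.2 h2)] at h0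
  rw [setIntegral_eq_integral_of_tsupport hψ.2.2, setIntegral_eq_integral_of_tsupport hs']
  exact eq_neg_of_add_eq_zero_left h0

/-- Weak derivatives are stable under `L²` convergence. -/
theorem HasWeakDeriv.of_tendsto {e : SpaceTime n}
    {f g : ℕ → SpaceTime n → F} {f₀ g₀ : SpaceTime n → F}
    (h : ∀ k, HasWeakDeriv O e (f k) (g k)) (hf : ∀ k, MemLp (f k) 2 (volume.restrict O))
    (hg : ∀ k, MemLp (g k) 2 (volume.restrict O)) (hf₀ : MemLp f₀ 2 (volume.restrict O))
    (hg₀ : MemLp g₀ 2 (volume.restrict O))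
    (hfl : Tendsto (fun k => eLpNorm (fun p => f k p - f₀ p) 2 (volume.restrict O)) atTop (𝓝 0))
    (hgl : Tendsto (fun k => eLpNorm (fun p => g k p - g₀ p) 2 (volume.restrict O)) atTop (𝓝 0)) :
    HasWeakDeriv O e f₀ g₀ := by
  refine ⟨locallyIntegrableOn_of_memLp (by norm_num) hf₀,
    locallyIntegrableOn_of_memLp (by norm_num) hg₀, fun ψ hψ => ?_⟩
  have h1 := tendsto_integral_bilin (ContinuousLinearMap.lsmul ℝ ℝ)
    ((hψ.continuous_fderiv_apply e).memLp_of_hasCompactSupport (p := 2) (μ := volume.restrict O)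
      (hasCompactSupport_fderiv_apply hψ.2.1 e)) hf hf₀ hfl
  have h2 := tendsto_integral_bilin (ContinuousLinearMap.lsmul ℝ ℝ)
    (hψ.1.continuous.memLp_of_hasCompactSupport (p := 2) (μ := volume.restrict O) hψ.2.1) hg hg₀ hgl
  simp only [ContinuousLinearMap.lsmul_apply] at h1 h2
  refine tendsto_nhds_unique h1 (h2.neg.congr fun k => ?_)
  exact ((h k).2.2 ψ hψ).symm

/-- Adding a constant does not change weak derivatives. -/
theorem HasWeakDeriv.add_const [CompleteSpace F] (hO : IsOpen O) {e : SpaceTime n}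
    {f g : SpaceTime n → F} (h : HasWeakDeriv O e f g) (c : F) :
    HasWeakDeriv O e (fun p => f p + c) g := by
  have hc := HasWeakDeriv.of_contDiffOn hO (U := fun _ : SpaceTime n => c) contDiffOn_const e
  refine ⟨h.1.add hc.1, h.2.1, fun ψ hψ => ?_⟩
  have hs' : tsupport (fun p => fderiv ℝ ψ p e) ⊆ O :=
    (tsupport_fderiv_apply_subset_tsupport e).trans hψ.2.2
  have hi := fun {f : SpaceTime n → F} (hf : LocallyIntegrableOn f O volume) =>
    (integrable_smul_of_tsupport_subset (hψ.continuous_fderiv_apply e)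
      (hasCompactSupport_fderiv_apply hψ.2.1 e) hs' hf).integrableOn (s := O)
  have h0 := hc.2.2 ψ hψ
  simp only [smul_add]
  rw [integral_add (hi h.1) (hi hc.1), h0, h.2.2 ψ hψ]
  simp

theorem HasWeakDeriv.congr {e : SpaceTime n} {f f' g g' : SpaceTime n → F}
    (h : HasWeakDeriv O e f g) (hf : f =ᵐ[volume.restrict O] f')
    (hg : g =ᵐ[volume.restrict O] g') : HasWeakDeriv O e f' g' := by
  refine ⟨h.1.congr hf, h.2.1.congr hg, fun ψ hψ => ?_⟩
  have h1 : ∫ p in O, fderiv ℝ ψ p e • f' p = ∫ p in O, fderiv ℝ ψ p e • f p := by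
    refine integral_congr_ae ?_
    filter_upwards [hf] with p hp
    rw [hp]
  have h2 : ∫ p in O, ψ p • g' p = ∫ p in O, ψ p • g p := by
    refine integral_congr_ae ?_
    filter_upwards [hg] with p hp
    rw [hp]
  rw [h1, h2, h.2.2 ψ hψ]

/-- `U k → u` in `L²(O)` and a.e., with `U k ∈ C¹(O) ∩ L²(O)`. -/
structure C1Approx (O : Set (SpaceTime n)) (U : ℕ → SpaceTime n → F) (u : SpaceTime n → F) :
    Prop where
  contDiffOn : ∀ k, ContDiffOn ℝ 1 (U k) O
  memLp : ∀ k, MemLp (U k) 2 (volume.restrict O)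
  memLp_lim : MemLp u 2 (volume.restrict O)
  tendsto : Tendsto (fun k => eLpNorm (fun p => U k p - u p) 2 (volume.restrict O)) atTop (𝓝 0)
  tendsto_ae : ∀ᵐ p ∂(volume.restrict O), Tendsto (fun k => U k p) atTop (𝓝 (u p))

/-- The directional derivatives of `U k` along `e` converge to `g` in `L²(O)`. -/
def DerivTendsto (O : Set (SpaceTime n)) (e : SpaceTime n) (U : ℕ → SpaceTime n → F)
    (g : SpaceTime n → F) : Prop :=
  MemLp g 2 (volume.restrict O) ∧
    Tendsto (fun k => eLpNorm (fun p => fderiv ℝ (U k) p e - g p) 2 (volume.restrict O))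
      atTop (𝓝 0)

theorem C1Approx.aestronglyMeasurable_fderiv (hO : IsOpen O) {U : ℕ → SpaceTime n → F}
    {u : SpaceTime n → F} (h : C1Approx O U u) (e : SpaceTime n) (k : ℕ) :
    AEStronglyMeasurable (fun p => fderiv ℝ (U k) p e) (volume.restrict O) :=
  (continuousOn_fderiv_apply hO (h.contDiffOn k) e).aestronglyMeasurable hO.measurableSet

/-- The factors `DΘ(U k)` are uniformly bounded and converge a.e., while the derivatives of `U k`
converge in `L²`; so the products converge in `L²`. -/
theorem DerivTendsto.comp [CompleteSpace F] (hO : IsOpen O) {U : ℕ → SpaceTime n → F}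
    {u g : SpaceTime n → F} {e : SpaceTime n} (h : C1Approx O U u) (hg : DerivTendsto O e U g)
    {Θ : F → G} (hΘ : ContDiff ℝ 1 Θ) {C : ℝ} (hC : ∀ z, ‖fderiv ℝ Θ z‖ ≤ C) :
    DerivTendsto O e (fun k p => Θ (U k p)) fun p => fderiv ℝ Θ (u p) (g p) := by
  have hΘ' : Continuous (fderiv ℝ Θ) := hΘ.continuous_fderiv (by norm_num)
  constructor
  · refine (hg.1.norm.const_mul C).mono' ?_ (ae_of_all _ fun p => ?_)
    · exact isBoundedBilinearMap_apply.continuous.comp_aestronglyMeasurable₂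
        (hΘ'.comp_aestronglyMeasurable h.memLp_lim.1) hg.1.1
    · exact (fderiv ℝ Θ (u p)).le_of_opNorm_le (hC _) _
  have h1 := tendsto_eLpNorm_clm_apply (μ := volume.restrict O)
    (A := fun k p => fderiv ℝ Θ (U k p)) (A₀ := fun p => fderiv ℝ Θ (u p))
    (g := fun k p => fderiv ℝ (U k) p e) (g₀ := g) (C := C)
    (fun k => hΘ'.comp_aestronglyMeasurable (h.memLp k).1)
    (fun k => ae_of_all _ fun p => hC _)
    (by filter_upwards [h.tendsto_ae] with p hp using (hΘ'.tendsto _).comp hp)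
    (h.aestronglyMeasurable_fderiv hO e) hg.1 hg.2
  refine h1.congr fun k => eLpNorm_congr_ae ?_
  filter_upwards [ae_restrict_mem hO.measurableSet] with p hp
  have hU := ((h.contDiffOn k).differentiableOn (by norm_num)).differentiableAt (hO.mem_nhds hp)
  have := fderiv_comp p (hΘ.differentiable (by norm_num) (U k p)) hU
  rw [show (fun p => Θ (U k p)) = Θ ∘ U k from rfl, this]
  rfl

theorem norm_sub_le_of_fderiv_le {Θ : F → G} (hΘ : ContDiff ℝ 1 Θ) {C : ℝ}
    (hC : ∀ z, ‖fderiv ℝ Θ z‖ ≤ C) (a b : F) : ‖Θ a - Θ b‖ ≤ C * ‖a - b‖ :=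
  Convex.norm_image_sub_le_of_norm_fderiv_le (fun x _ => hΘ.differentiable (by norm_num) x)
    (fun x _ => hC x) convex_univ (mem_univ b) (mem_univ a)

/-- `Θ` is Lipschitz. The normalization `Θ 0 = 0` keeps `Θ(u)` in `L²` when `O` has infinite
measure. -/
theorem C1Approx.comp {U : ℕ → SpaceTime n → F} {u : SpaceTime n → F}
    (h : C1Approx O U u) {Θ : F → G} (hΘ : ContDiff ℝ 1 Θ) {C : ℝ}
    (hC : ∀ z, ‖fderiv ℝ Θ z‖ ≤ C) (h0 : Θ 0 = 0) :
    C1Approx O (fun k p => Θ (U k p)) fun p => Θ (u p) := by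
  have hL := norm_sub_le_of_fderiv_le hΘ hC
  have hm : ∀ {f : SpaceTime n → F}, MemLp f 2 (volume.restrict O) →
      MemLp (fun p => Θ (f p)) 2 (volume.restrict O) := fun {f} hf => by
    refine (hf.norm.const_mul C).mono' (hΘ.continuous.comp_aestronglyMeasurable hf.1)
      (ae_of_all _ fun p => ?_)
    simpa [h0] using hL (f p) 0
  refine ⟨fun k => hΘ.comp_contDiffOn (h.contDiffOn k), fun k => hm (h.memLp k), hm h.memLp_lim,
    tendsto_eLpNorm_of_le_mul (fun k => ae_of_all _ fun p => hL _ _) h.tendsto, ?_⟩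
  filter_upwards [h.tendsto_ae] with p hp using (hΘ.continuous.tendsto _).comp hp

theorem C1Approx.hasWeakDeriv [CompleteSpace F] (hO : IsOpen O) {U : ℕ → SpaceTime n → F}
    {u g : SpaceTime n → F} {e : SpaceTime n} (h : C1Approx O U u) (hg : DerivTendsto O e U g) :
    HasWeakDeriv O e u g := by
  -- Convergence makes the derivatives square integrable only from some index on, so the sequence is
  -- shifted by `K`.
  obtain ⟨K, hK⟩ := (hg.2.eventually_lt_const ENNReal.zero_lt_top).exists_forall_of_atTop
  have hm : ∀ k, MemLp (fun p => fderiv ℝ (U (k + K)) p e) 2 (volume.restrict O) := fun k => by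
    have h1 : MemLp (fun p => fderiv ℝ (U (k + K)) p e - g p) 2 (volume.restrict O) :=
      ⟨(h.aestronglyMeasurable_fderiv hO e _).sub hg.1.1, hK _ (by omega)⟩
    exact (h1.add hg.1).ae_eq (ae_of_all _ fun p => by simp)
  exact HasWeakDeriv.of_tendsto (f := fun k => U (k + K))
    (fun k => HasWeakDeriv.of_contDiffOn hO (h.contDiffOn (k + K)) e) (fun k => h.memLp _) hm
    h.memLp_lim hg.1 ((tendsto_add_atTop_iff_nat K).2 h.tendsto)
    ((tendsto_add_atTop_iff_nat K).2 hg.2)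

/-- The chain rule for weak derivatives. -/
theorem C1Approx.hasWeakDeriv_comp [CompleteSpace F] [CompleteSpace G] (hO : IsOpen O)
    {U : ℕ → SpaceTime n → F} {u g : SpaceTime n → F} {e : SpaceTime n} (h : C1Approx O U u)
    (hg : DerivTendsto O e U g) {Θ : F → G} (hΘ : ContDiff ℝ 1 Θ) {C : ℝ}
    (hC : ∀ z, ‖fderiv ℝ Θ z‖ ≤ C) :
    HasWeakDeriv O e (fun p => Θ (u p)) fun p => fderiv ℝ Θ (u p) (g p) := by
  have hΘ' : ContDiff ℝ 1 fun z => Θ z - Θ 0 := hΘ.sub contDiff_const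
  have hd : fderiv ℝ (fun z => Θ z - Θ 0) = fderiv ℝ Θ := funext fun z => fderiv_sub_const _
  have hC' : ∀ z, ‖fderiv ℝ (fun z => Θ z - Θ 0) z‖ ≤ C := fun z => by rw [hd]; exact hC z
  have h1 : C1Approx O (fun k p => Θ (U k p) - Θ 0) fun p => Θ (u p) - Θ 0 :=
    h.comp (Θ := fun z => Θ z - Θ 0) hΘ' hC' (sub_self _)
  have h2 : DerivTendsto O e (fun k p => Θ (U k p) - Θ 0) fun p => fderiv ℝ Θ (u p) (g p) := by
    have := hg.comp (Θ := fun z => Θ z - Θ 0) hO h hΘ' hC'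
    rwa [hd] at this
  have h3 := (h1.hasWeakDeriv hO h2).add_const hO (Θ 0)
  simp only [sub_add_cancel] at h3
  exact h3

end WeakDeriv

/-! ### Approximation in `H¹₀` and in `V` -/

section Spaces

variable {n : ℕ} {F : Type*} [NormedAddCommGroup F] {O : Set (SpaceTime n)}
  {Ω : Set (EuclideanSpace ℝ (Fin n))} {T : ℝ}

theorem tendsto_eLpNorm_of_uniform {f : ℕ → SpaceTime n → F} (hf : ∀ k, Continuous (f k))
    {K : Set (SpaceTime n)} (hK : IsCompact K) (hs : ∀ k, ∀ p ∉ K, f k p = 0) {C : ℝ}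
    (hb : ∀ k p, ‖f k p‖ ≤ 1 / (k + 1 : ℝ) * C) (μ : Measure (SpaceTime n))
    [IsFiniteMeasureOnCompacts μ] : Tendsto (fun k => eLpNorm (f k) 2 μ) atTop (𝓝 0) := by
  have hbd : MemLp (K.indicator fun _ => |C|) 2 μ :=
    memLp_indicator_const 2 hK.measurableSet _ (Or.inr hK.measure_lt_top.ne)
  have ht : Tendsto (fun k : ℕ => 1 / (k + 1 : ℝ) * C) atTop (𝓝 0) := by
    simpa using tendsto_one_div_add_atTop_nhds_zero_nat.mul_const C
  have := tendsto_eLpNorm_two_of_dominated (f₀ := fun _ => (0 : F)) hbd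
    (fun k => (hf k).aestronglyMeasurable) (fun k => ae_of_all _ fun p => ?_)
    (ae_of_all _ fun p => squeeze_zero_norm (fun k => hb k p) ht)
  · simpa using this
  · by_cases hp : p ∈ K
    · rw [indicator_of_mem hp]
      refine (hb k p).trans ((le_abs_self _).trans ?_)
      rw [abs_mul]
      refine mul_le_of_le_one_left (abs_nonneg _) ?_
      rw [abs_of_nonneg (by positivity), div_le_one (by positivity)]
      linarith [(Nat.cast_nonneg k : (0 : ℝ) ≤ k)]
    · rw [hs k p hp, indicator_of_notMem hp, norm_zero]

theorem exists_subseq_tendsto_ae {α : Type*} [MeasurableSpace α] {μ : Measure α}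
    {f : ℕ → α → F} {f₀ : α → F} (hf : ∀ k, AEStronglyMeasurable (f k) μ)
    (hf₀ : AEStronglyMeasurable f₀ μ)
    (h : Tendsto (fun k => eLpNorm (fun x => f k x - f₀ x) 2 μ) atTop (𝓝 0)) :
    ∃ ns : ℕ → ℕ, StrictMono ns ∧
      ∀ᵐ x ∂μ, Tendsto (fun i => f (ns i) x) atTop (𝓝 (f₀ x)) :=
  (tendstoInMeasure_of_tendsto_eLpNorm (by norm_num) hf hf₀ h).exists_seq_tendsto_ae

/-- By Tonelli, almost every time slice is bounded by the essential supremum, and `(0, T)` has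
length `T`. Hence convergence in `V` implies convergence in `L²(Ω_T)`. -/
theorem lintegral_cylinder_le {f : SpaceTime n → F}
    (hf : AEStronglyMeasurable f (volume.restrict (cylinder Ω T)))
    (Df : Fin n → SpaceTime n → F) :
    ∫⁻ p in cylinder Ω T, ‖f p‖ₑ ^ 2 ≤ ENNReal.ofReal T * vNormSq Ω T f Df := by
  have hv : volume.restrict (cylinder Ω T) =
      (volume.restrict Ω).prod ((volume : Measure ℝ).restrict (Ioo 0 T)) :=
    (Measure.prod_restrict _ _).symm
  rw [hv] at hf ⊢
  rw [lintegral_prod_symm _ (hf.enorm.pow_const 2)]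
  calc _ ≤ ∫⁻ _ in Ioo (0 : ℝ) T, vNormSq Ω T f Df := by
        refine lintegral_mono_ae ?_
        filter_upwards [ENNReal.ae_le_essSup (μ := (volume : Measure ℝ).restrict (Ioo 0 T))
          (fun t : ℝ => ∫⁻ x in Ω, ‖f (x, t)‖ₑ ^ 2)] with t ht
        exact ht.trans le_self_add
    _ = _ := by simp [mul_comm]

theorem lintegral_grad_le (f : SpaceTime n → F) (Df : Fin n → SpaceTime n → F) (α : Fin n) :
    ∫⁻ p in cylinder Ω T, ‖Df α p‖ₑ ^ 2 ≤ vNormSq Ω T f Df :=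
  (Finset.single_le_sum (f := fun α => ∫⁻ p in cylinder Ω T, ‖Df α p‖ₑ ^ 2)
    (fun _ _ => zero_le) (Finset.mem_univ α)).trans le_add_self

variable [NormedSpace ℝ F]

/-- Mollification of a compactly supported `C¹` function. -/
theorem exists_smooth_close [CompleteSpace F] {W : SpaceTime n → F} (hW : ContDiff ℝ 1 W)
    (hc : HasCompactSupport W) {δ ε : ℝ} (hδ : 0 < δ) (hε : 0 < ε) :
    ∃ V : SpaceTime n → F, ContDiff ℝ ∞ V ∧ HasCompactSupport V ∧
      tsupport V ⊆ Metric.cthickening δ (tsupport W) ∧ (∀ p, ‖V p - W p‖ ≤ ε) ∧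
      ∀ p e, ‖fderiv ℝ V p e - fderiv ℝ W p e‖ ≤ ε * ‖e‖ := by
  have hu1 := hc.uniformContinuous_of_continuous hW.continuous
  have hdc : Continuous (fderiv ℝ W) := hW.continuous_fderiv (by norm_num)
  have hu2 := (hc.fderiv ℝ).uniformContinuous_of_continuous hdc
  obtain ⟨r1, hr1, h1⟩ := Metric.uniformContinuous_iff.1 hu1 ε hε
  obtain ⟨r2, hr2, h2⟩ := Metric.uniformContinuous_iff.1 hu2 ε hε
  let r := min δ (min r1 r2)
  have hr : 0 < r := lt_min hδ (lt_min hr1 hr2)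
  let φ : ContDiffBump (0 : SpaceTime n) := ⟨r / 2, r, by linarith, by linarith⟩
  let V := convolution (φ.normed volume) W (ContinuousLinearMap.lsmul ℝ ℝ) volume
  have hV : ∀ p, HasFDerivAt V
      (convolution (φ.normed volume) (fderiv ℝ W) (ContinuousLinearMap.lsmul ℝ ℝ) volume p) p := by
    intro p
    have := hc.hasFDerivAt_convolution_right (μ := volume) (ContinuousLinearMap.lsmul ℝ ℝ)
      (φ.continuous_normed (μ := volume)).locallyIntegrable hW p
    have hL : ContinuousLinearMap.precompR (SpaceTime n)
        (ContinuousLinearMap.lsmul ℝ ℝ : ℝ →L[ℝ] F →L[ℝ] F) = ContinuousLinearMap.lsmul ℝ ℝ := by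
      refine ContinuousLinearMap.ext fun a => ContinuousLinearMap.ext fun B =>
        ContinuousLinearMap.ext fun q => ?_
      rfl
    rw [hL] at this
    exact this
  refine ⟨V, ?_, ?_, ?_, ?_, ?_⟩
  · exact φ.hasCompactSupport_normed.contDiff_convolution_left _ φ.contDiff_normed
      hW.continuous.locallyIntegrable
  · exact φ.hasCompactSupport_normed.convolution _ hc
  · refine closure_minimal (fun p hp => ?_) Metric.isClosed_cthickening
    obtain ⟨a, ha, b, hb, rfl⟩ := support_convolution_subset_swap _ hp
    rw [φ.support_normed_eq, mem_ball_zero_iff] at hb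
    refine Metric.mem_cthickening_of_dist_le _ a _ _ (subset_tsupport _ ha) ?_
    rw [dist_eq_norm, add_sub_cancel_left]
    exact hb.le.trans (min_le_left _ _)
  · intro p
    rw [← dist_eq_norm]
    refine φ.dist_normed_convolution_le hW.continuous.aestronglyMeasurable fun x hx => ?_
    exact (h1 (lt_of_lt_of_le hx ((min_le_right _ _).trans (min_le_left _ _)))).le
  · intro p e
    rw [(hV p).fderiv]
    refine (ContinuousLinearMap.le_opNorm (_ - fderiv ℝ W p) e).trans ?_
    gcongr
    rw [← dist_eq_norm]
    refine φ.dist_normed_convolution_le hdc.aestronglyMeasurable fun x hx => ?_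
    exact (h2 (lt_of_lt_of_le hx ((min_le_right _ _).trans (min_le_right _ _)))).le

/-- Compactly supported `C¹` functions belong to `H¹₀`. -/
theorem memH10_of_contDiff [CompleteSpace F] (hO : IsOpen O) {W : SpaceTime n → F}
    (hW : ContDiff ℝ 1 W) (hc : HasCompactSupport W) (hs : tsupport W ⊆ O) :
    MemH10 O W (fun p => fderiv ℝ W p (tDir n)) fun α p => fderiv ℝ W p (xDir α) := by
  have hd : ∀ e, Continuous fun p => fderiv ℝ W p e := fun e =>
    (hW.continuous_fderiv (by norm_num)).clm_apply continuous_const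
  obtain ⟨δ, hδ, hδO⟩ := hc.isCompact.exists_cthickening_subset_open hO hs
  have hK : IsCompact (Metric.cthickening δ (tsupport W)) := hc.isCompact.cthickening
  choose V hV1 hV2 hV3 hV4 hV5 using fun k : ℕ =>
    exists_smooth_close hW hc hδ (Nat.one_div_pos_of_nat (n := k) (α := ℝ))
  have hz : ∀ p ∉ Metric.cthickening δ (tsupport W), p ∉ tsupport W := fun p hp h =>
    hp (Metric.self_subset_cthickening _ h)
  have hdt : ∀ e, Tendsto (fun k => eLpNorm (fun p => fderiv ℝ (V k) p e - fderiv ℝ W p e) 2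
      (volume.restrict O)) atTop (𝓝 0) := fun e =>
    tendsto_eLpNorm_of_uniform (f := fun k p => fderiv ℝ (V k) p e - fderiv ℝ W p e)
      (fun k => (((hV1 k).continuous_fderiv (by simp)).clm_apply continuous_const).sub (hd e)) hK
      (fun k p hp => by
        rw [image_eq_zero_of_notMem_tsupport fun h => hp (hV3 k (tsupport_fderiv_apply_subset_tsupport e h)),
          image_eq_zero_of_notMem_tsupport fun h => hz p hp (tsupport_fderiv_apply_subset_tsupport e h),
          sub_zero]) (C := ‖e‖) (fun k p => hV5 k p e) _
  refine ⟨hW.continuous.memLp_of_hasCompactSupport hc,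
    (hd _).memLp_of_hasCompactSupport (hasCompactSupport_fderiv_apply hc _),
    fun α => (hd _).memLp_of_hasCompactSupport (hasCompactSupport_fderiv_apply hc _),
    V, fun k => ⟨hV1 k, hV2 k, (hV3 k).trans hδO⟩, ?_, hdt _, fun α => hdt _⟩
  refine tendsto_eLpNorm_of_uniform (f := fun k p => V k p - W p)
    (fun k => (hV1 k).continuous.sub hW.continuous) hK
    (fun k p hp => ?_) (C := 1) (fun k p => by simpa using hV4 k p) _
  rw [image_eq_zero_of_notMem_tsupport fun h => hp (hV3 k h),
    image_eq_zero_of_notMem_tsupport (hz p hp), sub_zero]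

/-- Test functions approximating an element of `H¹₀`, in `H¹` and almost everywhere. -/
theorem MemH10.exists_approx {w wt : SpaceTime n → F} {Dw : Fin n → SpaceTime n → F}
    (h : MemH10 O w wt Dw) : ∃ W : ℕ → SpaceTime n → F, (∀ k, IsTestFunction O (W k)) ∧
      C1Approx O W w ∧ DerivTendsto O (tDir n) W wt ∧ ∀ α, DerivTendsto O (xDir α) W (Dw α) := by
  obtain ⟨h1, h2, h3, W, hW, l1, l2, l3⟩ := h
  obtain ⟨ns, hns, hae⟩ := exists_subseq_tendsto_ae
    (fun k => (hW k).1.continuous.aestronglyMeasurable) h1.1 l1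
  have ht := hns.tendsto_atTop
  exact ⟨fun k => W (ns k), fun k => hW _, ⟨fun k => ((hW _).1.of_le (by simp)).contDiffOn,
    fun k => (hW _).1.continuous.memLp_of_hasCompactSupport (hW _).2.1, h1, l1.comp ht, hae⟩,
    ⟨h2, l2.comp ht⟩, fun α => ⟨h3 α, (l3 α).comp ht⟩⟩

theorem isOpen_cylinder (hΩ : IsOpen Ω) : IsOpen (cylinder Ω T) := hΩ.prod isOpen_Ioo

/-- `C¹` functions approximating an element of `V`. -/
theorem MemV.exists_approx [CompleteSpace F] (hΩ : IsOpen Ω) {u : SpaceTime n → F}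
    (hu : MemV Ω T u) {Du : Fin n → SpaceTime n → F} (hDu : HasWeakGrad (cylinder Ω T) u Du) :
    ∃ U : ℕ → SpaceTime n → F, C1Approx (cylinder Ω T) U u ∧
      ∀ α, DerivTendsto (cylinder Ω T) (xDir α) U (Du α) := by
  obtain ⟨hm, Du', hDu', U, hU, hfin, hlim⟩ := hu
  have hO : IsOpen (cylinder Ω T) := isOpen_cylinder hΩ
  have hUm : ∀ k, AEStronglyMeasurable (U k) (volume.restrict (cylinder Ω T)) := fun k =>
    (hU k).continuousOn.aestronglyMeasurable hO.measurableSet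
  have hUdm : ∀ k e, AEStronglyMeasurable (fun p => fderiv ℝ (U k) p e)
      (volume.restrict (cylinder Ω T)) := fun k e =>
    (continuousOn_fderiv_apply hO (hU k) e).aestronglyMeasurable hO.measurableSet
  have hU2 : ∀ k, MemLp (U k) 2 (volume.restrict (cylinder Ω T)) := fun k =>
    (memLp_two_iff (hUm k)).2 ((lintegral_cylinder_le (hUm k) _).trans_lt
      (ENNReal.mul_lt_top ENNReal.ofReal_lt_top (hfin k)))
  have hUd2 : ∀ k α, MemLp (fun p => fderiv ℝ (U k) p (xDir α)) 2
      (volume.restrict (cylinder Ω T)) := fun k α =>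
    (memLp_two_iff (hUdm k _)).2 ((lintegral_grad_le (U k)
      (fun α p => fderiv ℝ (U k) p (xDir α)) α).trans_lt (hfin k))
  have l1 : Tendsto (fun k => eLpNorm (fun p => U k p - u p) 2 (volume.restrict (cylinder Ω T)))
      atTop (𝓝 0) := by
    rw [tendsto_eLpNorm_two_iff]
    have := ENNReal.Tendsto.const_mul (a := ENNReal.ofReal T) hlim (by simp)
    rw [mul_zero] at this
    exact tendsto_of_tendsto_of_tendsto_of_le_of_le tendsto_const_nhds this (fun _ => zero_le)
      fun k => lintegral_cylinder_le ((hUm k).sub hm) _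
  have l2 : ∀ α, Tendsto (fun k => eLpNorm (fun p => fderiv ℝ (U k) p (xDir α) - Du' α p) 2
      (volume.restrict (cylinder Ω T))) atTop (𝓝 0) := fun α => by
    rw [tendsto_eLpNorm_two_iff]
    exact tendsto_of_tendsto_of_tendsto_of_le_of_le tendsto_const_nhds hlim (fun _ => zero_le)
      fun k => lintegral_grad_le (fun p => U k p - u p)
        (fun α p => fderiv ℝ (U k) p (xDir α) - Du' α p) α
  have hD' : ∀ α, MemLp (Du' α) 2 (volume.restrict (cylinder Ω T)) := fun α =>
    memLp_of_tendsto_eLpNorm (fun k => hUd2 k α) (hDu' α).2.1.aestronglyMeasurable (l2 α)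
  obtain ⟨ns, hns, hae⟩ := exists_subseq_tendsto_ae hUm hm l1
  have ht := hns.tendsto_atTop
  refine ⟨fun k => U (ns k), ⟨fun k => hU _, fun k => hU2 _,
    memLp_of_tendsto_eLpNorm hU2 hm l1, l1.comp ht, hae⟩, fun α => ?_⟩
  -- The gradient supplied by membership in `V` and the prescribed one agree a.e. by uniqueness of
  -- weak derivatives.
  have heq := (hDu' α).ae_eq hO (hDu α)
  refine ⟨(hD' α).ae_eq heq, ((l2 α).comp ht).congr fun k => eLpNorm_congr_ae ?_⟩
  filter_upwards [heq] with p hp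
  rw [hp]

end Spaces

/-! ### The energy inequality by time translation -/

section Energy

variable {n : ℕ} {H : Type*} [NormedAddCommGroup H] [InnerProductSpace ℝ H]
  {O : Set (SpaceTime n)}

theorem tendsto_integral_inner {α ι : Type*} [MeasurableSpace α] {μ : Measure α} {l : Filter ι}
    {f : α → H} {g : ι → α → H} {g₀ : α → H} (hf : MemLp f 2 μ) (hg : ∀ k, MemLp (g k) 2 μ)
    (hg₀ : MemLp g₀ 2 μ)
    (hgl : Tendsto (fun k => eLpNorm (fun x => g k x - g₀ x) 2 μ) l (𝓝 0)) :
    Tendsto (fun k => ∫ x, inner ℝ (f x) (g k x) ∂μ) l (𝓝 (∫ x, inner ℝ (f x) (g₀ x) ∂μ)) := by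
  let B : H →L[ℝ] H →L[ℝ] ℝ := innerSL ℝ
  exact tendsto_integral_bilin B hf hg hg₀ hgl

theorem integrable_inner {α : Type*} [MeasurableSpace α] {μ : Measure α} {f g : α → H}
    (hf : MemLp f 2 μ) (hg : MemLp g 2 μ) : Integrable (fun x => inner ℝ (f x) (g x)) μ := by
  let B : H →L[ℝ] H →L[ℝ] ℝ := innerSL ℝ
  exact integrable_bilin B hf hg

theorem hasDerivAt_comp_translate {F : Type*} [NormedAddCommGroup F] [NormedSpace ℝ F]
    {W : SpaceTime n → F} (hW : ContDiff ℝ 1 W) (p e : SpaceTime n) (s : ℝ) :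
    HasDerivAt (fun s : ℝ => W (p + s • e)) (fderiv ℝ W (p + s • e) e) s := by
  have h1 : HasDerivAt (fun s : ℝ => p + s • e) e s := by
    simpa using ((hasDerivAt_id s).smul_const e).const_add p
  exact ((hW.differentiable (by norm_num) _).hasFDerivAt).comp_hasDerivAt s h1

/-- Differentiation of `s ↦ ∫ ⟪b, W(· + s e)⟫` under the integral sign. -/
theorem hasDerivAt_integral_inner_translate {b : SpaceTime n → H} {M : ℝ}
    (hb : AEStronglyMeasurable b volume) (hM : ∀ᵐ p, ‖b p‖ ≤ M) {W : SpaceTime n → H}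
    (hW : ContDiff ℝ 1 W) (hc : HasCompactSupport W) (e : SpaceTime n) (s₀ : ℝ) :
    HasDerivAt (fun s : ℝ => ∫ p, inner ℝ (b p) (W (p + s • e)))
      (∫ p, inner ℝ (b p) (fderiv ℝ W (p + s₀ • e) e)) s₀ := by
  have hd : Continuous fun p => fderiv ℝ W p e :=
    (hW.continuous_fderiv (by norm_num)).clm_apply continuous_const
  obtain ⟨C, hC⟩ := (hasCompactSupport_fderiv_apply hc e).exists_bound_of_continuous hd
  -- A compact set containing the supports of all `W(· + s e)` with `|s - s₀| < 1`; a constant on it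
  -- dominates the difference quotients.
  let K : Set (SpaceTime n) :=
    (fun q : SpaceTime n × ℝ => q.1 - q.2 • e) '' (tsupport W ×ˢ Metric.closedBall s₀ 1)
  have hK : IsCompact K := (hc.isCompact.prod (isCompact_closedBall _ _)).image (by fun_prop)
  have hKz : ∀ s ∈ Metric.ball s₀ 1, ∀ p ∉ K, p + s • e ∉ tsupport W := fun s hs p hp h =>
    hp ⟨(p + s • e, s), ⟨h, Metric.ball_subset_closedBall hs⟩, by simp⟩
  have hm : ∀ {V : SpaceTime n → H} (s : ℝ), Continuous V →
      AEStronglyMeasurable (fun p => inner ℝ (b p) (V (p + s • e))) volume := fun s hV =>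
    hb.inner (hV.comp (by fun_prop)).aestronglyMeasurable
  have hbound : ∀ {V : SpaceTime n → H} {C : ℝ}, (∀ p, ‖V p‖ ≤ C) →
      (∀ p ∉ tsupport W, V p = 0) → ∀ᵐ p, ∀ s ∈ Metric.ball s₀ 1,
        ‖(inner ℝ (b p) (V (p + s • e)) : ℝ)‖ ≤ K.indicator (fun _ => M * C) p := by
    intro V C hV hV0
    filter_upwards [hM] with p hp s hs
    by_cases hpK : p ∈ K
    · rw [indicator_of_mem hpK]
      refine (norm_inner_le_norm _ _).trans ?_
      exact mul_le_mul hp (hV _) (norm_nonneg _) ((norm_nonneg _).trans hp)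
    · rw [hV0 _ (hKz s hs p hpK), inner_zero_right, norm_zero, indicator_of_notMem hpK]
  have hint : ∀ C : ℝ, Integrable (K.indicator fun _ => M * C) (volume : Measure (SpaceTime n)) :=
    fun C => (integrable_indicator_iff hK.measurableSet).2
      (integrableOn_const hK.measure_lt_top.ne)
  obtain ⟨C', hC'⟩ := hc.exists_bound_of_continuous hW.continuous
  refine (hasDerivAt_integral_of_dominated_loc_of_deriv_le (𝕜 := ℝ) (μ := volume)
    (F := fun s p => inner ℝ (b p) (W (p + s • e)))
    (F' := fun s p => inner ℝ (b p) (fderiv ℝ W (p + s • e) e))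
    (bound := K.indicator fun _ => M * C)
    (Metric.ball_mem_nhds s₀ one_pos) (Eventually.of_forall fun s => hm s hW.continuous) ?_
    (hm s₀ hd) (hbound hC fun p hp => ?_) (hint C) (ae_of_all _ fun p s _ => ?_)).2
  · refine (hint C').mono' (hm s₀ hW.continuous) ?_
    filter_upwards [hbound hC' fun p hp => image_eq_zero_of_notMem_tsupport hp] with p hp
    exact hp s₀ (Metric.mem_ball_self one_pos)
  · exact image_eq_zero_of_notMem_tsupport (f := fun p => fderiv ℝ W p e) fun h =>
      hp (tsupport_fderiv_apply_subset_tsupport e h)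
  · exact (hasDerivAt_const s (b p)).inner ℝ (hasDerivAt_comp_translate hW p e s) |>.congr_deriv
      (by simp)

theorem fderiv_comp_translate {F : Type*} [NormedAddCommGroup F] [NormedSpace ℝ F]
    (W : SpaceTime n → F) (a p : SpaceTime n) :
    fderiv ℝ (fun q => W (q + a)) p = fderiv ℝ W (p + a) :=
  fderiv_comp_add_right a

/-- The energy inequality behind a weak equation `u_t = div Dv`, in which the test function `w` is
only spatially differentiable and `⟪u q - u p, w p⟫ ≤ ψ p (Ψ q - Ψ p)`. -/
theorem energy_inequality (hO : IsOpen O) {e : SpaceTime n}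
    {ι : Type*} [Fintype ι] {d : ι → SpaceTime n} {u w : SpaceTime n → H}
    {Dv Dw : ι → SpaceTime n → H} {Ψ ψ : SpaceTime n → ℝ} {M M' : ℝ}
    (hu : MemLp u 2 volume) (hM : ∀ᵐ p, ‖u p‖ ≤ M) (hDv : ∀ α, MemLp (Dv α) 2 volume)
    (heq : ∀ W : SpaceTime n → H, ContDiff ℝ 1 W → HasCompactSupport W → tsupport W ⊆ O →
      ∫ p, inner ℝ (u p) (fderiv ℝ W p e) = ∑ α, ∫ p, inner ℝ (Dv α p) (fderiv ℝ W p (d α)))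
    (hψ : IsTestFunction O ψ) {W : ℕ → SpaceTime n → H} (hW : ∀ k, ContDiff ℝ 1 (W k))
    (hWs : ∀ k, tsupport (W k) ⊆ tsupport ψ) (hw : MemLp w 2 volume)
    (hDw : ∀ α, MemLp (Dw α) 2 volume)
    (hWw : Tendsto (fun k => eLpNorm (fun p => W k p - w p) 2 volume) atTop (𝓝 0))
    (hDWw : ∀ α, Tendsto (fun k => eLpNorm (fun p => fderiv ℝ (W k) p (d α) - Dw α p) 2 volume)
      atTop (𝓝 0))
    (hΨ : AEStronglyMeasurable Ψ volume) (hM' : ∀ᵐ p, ‖Ψ p‖ ≤ M')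
    (hconv : ∀ p q, inner ℝ (u q - u p) (w p) ≤ ψ p * (Ψ q - Ψ p)) :
    ∑ α, ∫ p, inner ℝ (Dv α p) (Dw α p) ≤ ∫ p, Ψ p * fderiv ℝ ψ p e := by
  set J₀ := ∑ α, ∫ p, inner ℝ (Dv α p) (Dw α p)
  have hcs : ∀ k, HasCompactSupport (W k) := fun k =>
    hψ.2.1.isCompact.of_isClosed_subset (isClosed_tsupport _) (hWs k)
  obtain ⟨δ, hδ, hδO⟩ := hψ.2.1.isCompact.exists_cthickening_subset_open hO hψ.2.2
  let I : ℕ → ℝ → ℝ := fun k s => ∫ p, inner ℝ (u p) (W k (p + s • e))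
  let J : ℕ → ℝ → ℝ := fun k s => ∑ α, ∫ p, inner ℝ (Dv α p) (fderiv ℝ (W k) (p + s • e) (d α))
  have hsm : ∀ᶠ s : ℝ in 𝓝 0, ‖s • e‖ < δ := by
    have : Tendsto (fun s : ℝ => ‖s • e‖) (𝓝 0) (𝓝 0) := by
      have : Continuous fun s : ℝ => ‖s • e‖ := by fun_prop
      simpa using this.tendsto 0
    exact this.eventually_lt_const hδ
  -- For small `s` the translate of `W k` is still supported in `O`, so it is admissible in the
  -- equation, which trades the derivative along `e` for derivatives along the `d α`.
  have hIJ : ∀ k s, ‖s • e‖ < δ → HasDerivAt (I k) (J k s) s := by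
    intro k s hs
    have h1 := hasDerivAt_integral_inner_translate hu.1 hM (hW k) (hcs k) e s
    have h2 : ContDiff ℝ 1 fun q => W k (q + s • e) := (hW k).comp (by fun_prop)
    have h3 : tsupport (fun q => W k (q + s • e)) ⊆ Metric.cthickening δ (tsupport ψ) := by
      refine closure_minimal (fun q hq => ?_) Metric.isClosed_cthickening
      refine Metric.mem_cthickening_of_dist_le _ (q + s • e) _ _ (hWs k (subset_tsupport _ hq)) ?_
      rw [dist_eq_norm, sub_add_cancel_left, norm_neg]
      exact hs.le
    have h4 := heq _ h2 (hψ.2.1.isCompact.cthickening.of_isClosed_subset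
      (isClosed_tsupport _) h3) (h3.trans hδO)
    simp only [fderiv_comp_translate] at h4
    rw [h4] at h1
    exact h1
  have hdW : ∀ k α, MemLp (fun p => fderiv ℝ (W k) p (d α)) 2 volume := fun k α =>
    (((hW k).continuous_fderiv (by norm_num)).clm_apply
      continuous_const).memLp_of_hasCompactSupport (hasCompactSupport_fderiv_apply (hcs k) _)
  have hmp := fun s : ℝ => measurePreserving_add_smul e s
  -- The limit must be joint in `k` and `s`, because the intermediate point chosen later by the mean
  -- value theorem depends on `k`.
  have hJ : Tendsto (fun q : ℕ × ℝ => J q.1 q.2) (atTop ×ˢ 𝓝 0) (𝓝 J₀) := by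
    refine tendsto_finsetSum _ fun α _ => ?_
    refine tendsto_integral_inner (hDv α)
      (fun q => (hdW q.1 α).comp_measurePreserving (hmp q.2)) (hDw α) ?_
    have t1 : Tendsto (fun q : ℕ × ℝ => eLpNorm (fun p =>
        fderiv ℝ (W q.1) (p + q.2 • e) (d α) - Dw α (p + q.2 • e)) 2 volume)
        (atTop ×ˢ 𝓝 0) (𝓝 0) := by
      refine ((hDWw α).comp tendsto_fst).congr fun q => ?_
      exact (eLpNorm_comp_measurePreserving ((hdW q.1 α).1.sub (hDw α).1) (hmp q.2)).symm
    have t2 : Tendsto (fun q : ℕ × ℝ => eLpNorm (fun p =>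
        Dw α (p + q.2 • e) - Dw α p) 2 volume) (atTop ×ˢ 𝓝 0) (𝓝 0) :=
      (tendsto_eLpNorm_translate (hDw α) e).comp tendsto_snd
    refine (tendsto_eLpNorm_add (fun q => ?_) (fun q => ?_) t1 t2).congr fun q => ?_
    · exact ((hdW q.1 α).1.sub (hDw α).1).comp_measurePreserving (hmp q.2)
    · exact ((hDw α).1.comp_measurePreserving (hmp q.2)).sub (hDw α).1
    · simp only [sub_add_sub_cancel]
  have hwt : ∀ s : ℝ, MemLp (fun p => w (p + s • e)) 2 volume := fun s =>
    hw.comp_measurePreserving (hmp s)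
  have hW2 : ∀ k, MemLp (W k) 2 volume := fun k =>
    (hW k).continuous.memLp_of_hasCompactSupport (hcs k)
  have hI : ∀ s, Tendsto (fun k => I k s) atTop (𝓝 (∫ p, inner ℝ (u p) (w (p + s • e)))) := by
    intro s
    refine tendsto_integral_inner hu (fun k => (hW2 k).comp_measurePreserving (hmp s)) (hwt s) ?_
    refine hWw.congr fun k => ?_
    exact (eLpNorm_comp_measurePreserving ((hW2 k).1.sub hw.1) (hmp s)).symm
  let R : ℝ → ℝ := fun s => ∫ p, inner ℝ (Ψ p) (ψ (p + s • e))
  have hψ1 : ContDiff ℝ 1 ψ := hψ.1.of_le (by simp)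
  have hR : HasDerivAt R (∫ p, inner ℝ (Ψ p) (fderiv ℝ ψ (p + (0 : ℝ) • e) e)) 0 :=
    hasDerivAt_integral_inner_translate hΨ hM' hψ1 hψ.2.1 e 0
  have hψΨ : ∀ s t : ℝ, Integrable (fun p => ψ (p + s • e) * Ψ (p + t • e)) volume := by
    intro s t
    have h1 : Integrable (fun p => ψ (p + s • e)) volume :=
      (hmp s).integrable_comp_of_integrable
        (hψ.1.continuous.integrable_of_hasCompactSupport hψ.2.1)
    refine h1.mul_bdd (c := M') (hΨ.comp_measurePreserving (hmp t)) ?_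
    exact (hmp t).quasiMeasurePreserving.ae hM'
  -- A change of variables moves the translation onto `u`; then `hconv` applies pointwise with `q =
  -- p - s e`.
  have hkey : ∀ s : ℝ, (∫ p, inner ℝ (u p) (w (p + s • e))) - ∫ p, inner ℝ (u p) (w p) ≤
      R s - R 0 := by
    intro s
    have hut : MemLp (fun p => u (p + (-s) • e)) 2 volume := hu.comp_measurePreserving (hmp (-s))
    have e1 : ∫ p, inner ℝ (u p) (w (p + s • e)) = ∫ p, inner ℝ (u (p + (-s) • e)) (w p) := by
      rw [← integral_add_right_eq_self (fun p => inner ℝ (u (p + (-s) • e)) (w p)) (s • e)]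
      simp
    have e2 : R s = ∫ p, ψ p * Ψ (p + (-s) • e) := by
      simp only [R]
      rw [← integral_add_right_eq_self (fun p => ψ p * Ψ (p + (-s) • e)) (s • e)]
      simp
    have e3 : R 0 = ∫ p, ψ p * Ψ p := by simp [R]
    have i1 : Integrable (fun p => ψ p * Ψ (p + (-s) • e)) volume := by
      simpa using hψΨ 0 (-s)
    have i2 : Integrable (fun p => ψ p * Ψ p) volume := by
      simpa using hψΨ 0 0
    rw [e1, e2, e3, ← integral_sub (integrable_inner hut hw) (integrable_inner hu hw),
      ← integral_sub i1 i2]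
    refine integral_mono ((integrable_inner hut hw).sub (integrable_inner hu hw)) (i1.sub i2)
      fun p => ?_
    have := hconv p (p + (-s) • e)
    rw [inner_sub_left, mul_sub] at this
    exact this
  have hmain : ∀ ε > 0, J₀ - ε ≤ ∫ p, Ψ p * fderiv ℝ ψ p e := by
    intro ε hε
    have h1 := hJ.eventually_const_lt (show J₀ - ε < J₀ by linarith)
    obtain ⟨P, hP, Q, hQ, hPQ⟩ := eventually_prod_iff.1 h1
    obtain ⟨r, hr, hrQ⟩ := Metric.eventually_nhds_iff_ball.1 (hQ.and hsm)
    have hslope : ∀ h ∈ Ioo (0 : ℝ) r, J₀ - ε ≤ h⁻¹ • (R (0 + h) - R 0) := by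
      intro h hh
      have hmem : ∀ s ∈ Icc 0 h, s ∈ Metric.ball (0 : ℝ) r := fun s hs => by
        rw [mem_ball_zero_iff, Real.norm_of_nonneg hs.1]
        exact hs.2.trans_lt hh.2
      -- Mean value theorem for `I k` on `[0, h]`. The bound survives `k → ∞` with `h` fixed; only
      -- afterwards does `h` tend to `0` from the right.
      have h2 : ∀ᶠ k in atTop, (J₀ - ε) * h ≤ I k h - I k 0 := by
        filter_upwards [hP] with k hk
        obtain ⟨c, hc, hcs⟩ := exists_hasDerivAt_eq_slope (I k) (J k) hh.1
          (fun s hs => (hIJ k s (hrQ s (hmem s hs)).2).continuousAt.continuousWithinAt)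
          (fun s hs => hIJ k s (hrQ s (hmem s (Ioo_subset_Icc_self hs))).2)
        have h3 := hPQ hk (hrQ c (hmem c (Ioo_subset_Icc_self hc))).1
        simp only at h3
        rw [hcs, sub_zero, lt_div_iff₀ hh.1] at h3
        exact h3.le
      have h3 := ge_of_tendsto ((hI h).sub (hI 0)) h2
      simp only [zero_smul, add_zero] at h3
      have h4 := h3.trans (hkey h)
      rw [smul_eq_mul, zero_add, inv_mul_eq_div, le_div_iff₀ hh.1]
      exact h4
    have h5 := hR.tendsto_slope_zero_right
    have h6 := ge_of_tendsto h5 (by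
      filter_upwards [Ioo_mem_nhdsGT hr] with h hh using hslope h hh)
    simpa [mul_comm] using h6
  exact le_of_forall_pos_le_add fun ε hε => by linarith [hmain ε hε]

end Energy

/-! ### Testing the system with `ψ ∇Φ(u)` -/

section Solution

/-- A `C¹` function agrees on any ball with a `C¹` function of bounded derivative. -/
theorem exists_contDiff_bounded_fderiv {E G : Type*} [NormedAddCommGroup E] [InnerProductSpace ℝ E]
    [FiniteDimensional ℝ E] [NormedAddCommGroup G] [NormedSpace ℝ G] {Θ : E → G}
    (hΘ : ContDiff ℝ 1 Θ) (M : ℝ) : ∃ Θ' : E → G, ContDiff ℝ 1 Θ' ∧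
      (∃ C, ∀ z, ‖fderiv ℝ Θ' z‖ ≤ C) ∧
      ∀ z, ‖z‖ ≤ M → Θ' z = Θ z ∧ fderiv ℝ Θ' z = fderiv ℝ Θ z := by
  let χ : ContDiffBump (0 : E) :=
    -- The inner radius exceeds `M`, so the two functions agree near every point of the closed ball
    -- and their derivatives agree there too.
    ⟨max M 0 + 1, max M 0 + 2, by linarith [le_max_right M 0], by linarith⟩
  have h1 : ContDiff ℝ 1 fun z => χ z • Θ z := χ.contDiff.smul hΘ
  have h2 : HasCompactSupport fun z => χ z • Θ z := χ.hasCompactSupport.smul_right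
  refine ⟨fun z => χ z • Θ z, h1,
    (h2.fderiv ℝ).exists_bound_of_continuous (h1.continuous_fderiv (by norm_num)), fun z hz => ?_⟩
  have h3 : (fun z => χ z • Θ z) =ᶠ[𝓝 z] Θ := by
    have : Metric.ball (0 : E) (max M 0 + 1) ∈ 𝓝 z := by
      apply Metric.isOpen_ball.mem_nhds
      rw [mem_ball_zero_iff]
      exact hz.trans_lt ((le_max_left M 0).trans_lt (lt_add_one _))
    filter_upwards [this] with y hy
    rw [χ.one_of_mem_closedBall (Metric.ball_subset_closedBall hy), one_smul]
  exact ⟨h3.eq_of_nhds, h3.fderiv_eq⟩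

variable {n : ℕ} {O : Set (SpaceTime n)}

theorem integral_inner_indicator {H : Type*} [NormedAddCommGroup H] [InnerProductSpace ℝ H]
    (hO : IsOpen O) (f g : SpaceTime n → H) :
    ∫ p, inner ℝ (O.indicator f p) (g p) = ∫ p in O, inner ℝ (f p) (g p) := by
  rw [← integral_indicator hO.measurableSet]
  congr 1
  funext p
  by_cases hp : p ∈ O <;> simp [hp]

theorem eLpNorm_restrict_eq_of_forall_notMem {F : Type*} [NormedAddCommGroup F]
    {f : SpaceTime n → F} (hf : ∀ p ∉ O, f p = 0) (q : ENNReal) :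
    eLpNorm f q (volume.restrict O) = eLpNorm f q volume :=
  eLpNorm_restrict_eq_of_support_subset fun p hp => by
    by_contra h
    exact hp (hf p h)

theorem ae_of_ae_restrict {O : Set (SpaceTime n)} (hO : IsOpen O) {P : SpaceTime n → Prop}
    (h : ∀ᵐ p ∂(volume.restrict O), P p) (h' : ∀ p ∉ O, P p) : ∀ᵐ p, P p := by
  filter_upwards [(ae_restrict_iff' hO.measurableSet).1 h] with p hp
  by_cases hpO : p ∈ O
  exacts [hp hpO, h' p hpO]

theorem IsTestFunction.exists_bound {F : Type*} [NormedAddCommGroup F] [NormedSpace ℝ F]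
    {ψ : SpaceTime n → F} (hψ : IsTestFunction O ψ) (e : SpaceTime n) :
    ∃ C, 0 ≤ C ∧ ∀ p, ‖ψ p‖ ≤ C ∧ ‖fderiv ℝ ψ p e‖ ≤ C := by
  obtain ⟨C₁, h₁⟩ := hψ.2.1.exists_bound_of_continuous hψ.1.continuous
  obtain ⟨C₂, h₂⟩ := (hasCompactSupport_fderiv_apply hψ.2.1 e).exists_bound_of_continuous
    (hψ.continuous_fderiv_apply e)
  refine ⟨max C₁ C₂, ((norm_nonneg _).trans (h₁ 0)).trans (le_max_left _ _), fun p => ?_⟩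
  exact ⟨(h₁ p).trans (le_max_left _ _), (h₂ p).trans (le_max_right _ _)⟩

variable {N : ℕ} {Ω : Set (EuclideanSpace ℝ (Fin n))} {T : ℝ}
  {Φ : EuclideanSpace ℝ (Fin N) → ℝ} {u : SpaceTime n → EuclideanSpace ℝ (Fin N)}
  {Du : Fin n → SpaceTime n → EuclideanSpace ℝ (Fin N)} {M : ℝ}

/-- The chain rule for `Θ(u)` with `u ∈ V` bounded. -/
theorem hasWeakGrad_comp {G : Type*} [NormedAddCommGroup G] [NormedSpace ℝ G] [CompleteSpace G]
    (hΩ : IsOpen Ω) {U : ℕ → SpaceTime n → EuclideanSpace ℝ (Fin N)}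
    (hU : C1Approx (cylinder Ω T) U u)
    (hDU : ∀ α, DerivTendsto (cylinder Ω T) (xDir α) U (Du α))
    (hM : ∀ᵐ p ∂(volume.restrict (cylinder Ω T)), ‖u p‖ ≤ M)
    {Θ : EuclideanSpace ℝ (Fin N) → G} (hΘ : ContDiff ℝ 1 Θ) :
    HasWeakGrad (cylinder Ω T) (fun p => Θ (u p)) (fun α p => fderiv ℝ Θ (u p) (Du α p)) ∧
      ∀ α, MemLp (fun p => fderiv ℝ Θ (u p) (Du α p)) 2 (volume.restrict (cylinder Ω T)) := by
  have hO : IsOpen (cylinder Ω T) := isOpen_cylinder hΩ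
  obtain ⟨Θ', h1, ⟨C, hC⟩, h2⟩ := exists_contDiff_bounded_fderiv hΘ M
  have e1 : (fun p => Θ' (u p)) =ᵐ[volume.restrict (cylinder Ω T)] fun p => Θ (u p) := by
    filter_upwards [hM] with p hp using (h2 _ hp).1
  have e2 : ∀ α, (fun p => fderiv ℝ Θ' (u p) (Du α p)) =ᵐ[volume.restrict (cylinder Ω T)]
      fun p => fderiv ℝ Θ (u p) (Du α p) := fun α => by
    filter_upwards [hM] with p hp
    rw [(h2 _ hp).2]
  exact ⟨fun α => (hU.hasWeakDeriv_comp hO (hDU α) h1 hC).congr e1 (e2 α),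
    fun α => ((hDU α).comp hO hU h1 hC).1.ae_eq (e2 α)⟩

/-- The weak formulation, extended to the whole space-time. -/
theorem IsWeakSolution.integral_eq (hΩ : IsOpen Ω) (hu : IsWeakSolution Ω T Φ u)
    (hu2 : MemLp u 2 (volume.restrict (cylinder Ω T)))
    {Dv : Fin n → SpaceTime n → EuclideanSpace ℝ (Fin N)}
    (hDv : HasWeakGrad (cylinder Ω T) (fun p => gradient Φ (u p)) Dv)
    (hDv2 : ∀ α, MemLp (Dv α) 2 (volume.restrict (cylinder Ω T)))
    {W : SpaceTime n → EuclideanSpace ℝ (Fin N)} (hW : ContDiff ℝ 1 W)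
    (hc : HasCompactSupport W) (hs : tsupport W ⊆ cylinder Ω T) :
    ∫ p, inner ℝ ((cylinder Ω T).indicator u p) (fderiv ℝ W p (tDir n)) =
      ∑ α, ∫ p, inner ℝ ((cylinder Ω T).indicator (Dv α) p) (fderiv ℝ W p (xDir α)) := by
  have hO : IsOpen (cylinder Ω T) := isOpen_cylinder hΩ
  obtain ⟨-, Dv', hDv', heq⟩ := hu
  have hmem := memH10_of_contDiff hO hW hc hs
  have h0 := heq _ _ _ hmem
  have hae : ∀ᵐ p ∂(volume.restrict (cylinder Ω T)), ∀ α, Dv' α p = Dv α p :=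
    ae_all_iff.2 fun α => (hDv' α).ae_eq hO (hDv α)
  have h1 : ∫ p in cylinder Ω T, (- inner ℝ (u p) (fderiv ℝ W p (tDir n)) +
      ∑ α, inner ℝ (Dv α p) (fderiv ℝ W p (xDir α))) = 0 := by
    rw [← h0]
    refine integral_congr_ae ?_
    filter_upwards [hae] with p hp
    simp only [hp]
  have hi : ∀ α, Integrable (fun p => inner ℝ (Dv α p) (fderiv ℝ W p (xDir α)))
      (volume.restrict (cylinder Ω T)) := fun α => integrable_inner (hDv2 α) (hmem.2.2.1 α)
  have hi0 : Integrable (fun p => - inner ℝ (u p) (fderiv ℝ W p (tDir n)))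
      (volume.restrict (cylinder Ω T)) := (integrable_inner hu2 hmem.2.1).neg
  rw [integral_add hi0 (integrable_finsetSum _ fun α _ => hi α),
    integral_neg, integral_finsetSum _ fun α _ => hi α] at h1
  simp only [integral_inner_indicator hO]
  linarith

/-- Testing the system with `ψ ∇Φ(u)`. -/
theorem IsWeakSolution.energy (hΩ : IsOpen Ω) (hC : ContDiff ℝ 2 Φ)
    (hconv : ∀ z ξ, 0 ≤ fderiv ℝ (fderiv ℝ Φ) z ξ ξ) (hu : IsWeakSolution Ω T Φ u)
    (hM : ∀ᵐ p ∂(volume.restrict (cylinder Ω T)), ‖u p‖ ≤ M)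
    {U : ℕ → SpaceTime n → EuclideanSpace ℝ (Fin N)} (hU : C1Approx (cylinder Ω T) U u)
    (hDU : ∀ α, DerivTendsto (cylinder Ω T) (xDir α) U (Du α)) {ψ : SpaceTime n → ℝ}
    (hψ : IsTestFunction (cylinder Ω T) ψ) (hψ0 : ∀ p, 0 ≤ ψ p) :
    ∑ α, ∫ p in cylinder Ω T, inner ℝ (fderiv ℝ (gradient Φ) (u p) (Du α p))
        (fderiv ℝ ψ p (xDir α) • gradient Φ (u p) +
          ψ p • fderiv ℝ (gradient Φ) (u p) (Du α p)) ≤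
      ∫ p in cylinder Ω T, (Φ (u p) - Φ 0) * fderiv ℝ ψ p (tDir n) := by
  have hO : IsOpen (cylinder Ω T) := isOpen_cylinder hΩ
  set O := cylinder Ω T
  set V := gradient Φ
  have hV : ContDiff ℝ 1 V := contDiff_gradient hC
  set Dv : Fin n → SpaceTime n → EuclideanSpace ℝ (Fin N) :=
    fun α p => fderiv ℝ V (u p) (Du α p)
  obtain ⟨hDv, hDv2⟩ := hasWeakGrad_comp hΩ hU hDU hM hV
  -- `u` is bounded but its approximations `U k` need not be, so `∇Φ(U k)` is replaced by `Θ(U k)`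
  -- with `Θ` globally Lipschitz and equal to `∇Φ` on the range of `u`.
  obtain ⟨Θ, hΘ, ⟨C, hΘC⟩, hΘV⟩ := exists_contDiff_bounded_fderiv hV M
  have hΘL := norm_sub_le_of_fderiv_le hΘ hΘC
  have hψ1 : ContDiff ℝ 1 ψ := hψ.1.of_le (by simp)
  have hψz : ∀ p ∉ O, ψ p = 0 := fun p hp =>
    image_eq_zero_of_notMem_tsupport fun h => hp (hψ.2.2 h)
  have hψdz : ∀ e, ∀ p ∉ O, fderiv ℝ ψ p e = 0 := fun e p hp =>
    image_eq_zero_of_notMem_tsupport (f := fun p => fderiv ℝ ψ p e) fun h =>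
      hp (hψ.2.2 (tsupport_fderiv_apply_subset_tsupport e h))
  -- Extension by zero lets the translations act on all of space-time; the convexity inequality
  -- holds for every pair of values, so the jump across the boundary is harmless.
  set v : SpaceTime n → EuclideanSpace ℝ (Fin N) := O.indicator u
  have hvu : ∀ p ∈ O, v p = u p := fun p hp => indicator_of_mem hp u
  have hv2 : MemLp v 2 volume := (memLp_indicator_iff_restrict hO.measurableSet).2 hU.memLp_lim
  have hvM : ∀ᵐ p, ‖v p‖ ≤ max M 0 := by
    refine ae_of_ae_restrict hO ?_ fun p hp => by simp [v, hp]
    filter_upwards [hM, ae_restrict_mem hO.measurableSet] with p hp hpO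
    rw [hvu p hpO]
    exact hp.trans (le_max_left _ _)
  have hbdd : ∀ {G : Type} [NormedAddCommGroup G] {f : EuclideanSpace ℝ (Fin N) → G},
      Continuous f → ∃ C, ∀ᵐ p, ‖f (v p)‖ ≤ C := fun {G} _ {f} hf => by
    obtain ⟨C, hC⟩ := (isCompact_closedBall (0 : EuclideanSpace ℝ (Fin N))
      (max M 0)).exists_bound_of_continuousOn hf.continuousOn
    refine ⟨C, ?_⟩
    filter_upwards [hvM] with p hp
    exact hC _ (mem_closedBall_zero_iff.2 hp)
  obtain ⟨CV, hCV⟩ := hbdd hV.continuous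
  obtain ⟨CΦ, hCΦ⟩ := hbdd (f := fun z => Φ z - Φ 0) (hC.continuous.sub continuous_const)
  have hVv : AEStronglyMeasurable (fun p => V (v p)) volume :=
    hV.continuous.comp_aestronglyMeasurable hv2.1
  have hsmul : ∀ {η : SpaceTime n → ℝ}, Continuous η → HasCompactSupport η →
      MemLp (fun p => η p • V (v p)) 2 volume := fun {η} hη hc => by
    refine MemLp.of_le_mul (c := CV) (hη.memLp_of_hasCompactSupport (p := 2) (μ := volume) hc)
      (hη.aestronglyMeasurable.smul hVv) ?_
    filter_upwards [hCV] with p hp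
    rw [norm_smul, mul_comm]
    gcongr
  have hDvI : ∀ α, MemLp (O.indicator (Dv α)) 2 volume := fun α =>
    (memLp_indicator_iff_restrict hO.measurableSet).2 (hDv2 α)
  have hWC : ∀ k, ContDiffOn ℝ 1 (fun p => Θ (U k p)) O := fun k =>
    hΘ.comp_contDiffOn (hU.contDiffOn k)
  have t1 : Tendsto (fun k => eLpNorm (fun p => Θ (U k p) - V (u p)) 2 (volume.restrict O))
      atTop (𝓝 0) := by
    refine tendsto_eLpNorm_of_le_mul (C := C) (fun k => ?_) hU.tendsto
    filter_upwards [hM] with p hp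
    rw [← (hΘV _ hp).1]
    exact hΘL _ _
  have t2 : ∀ α, Tendsto (fun k => eLpNorm (fun p =>
      fderiv ℝ (fun p => Θ (U k p)) p (xDir α) - Dv α p) 2 (volume.restrict O)) atTop (𝓝 0) := by
    intro α
    refine ((hDU α).comp hO hU hΘ hΘC).2.congr fun k => eLpNorm_congr_ae ?_
    filter_upwards [hM] with p hp
    simp only [Dv, (hΘV _ hp).2]
  have hmV : AEStronglyMeasurable (fun p => V (u p)) (volume.restrict O) :=
    hV.continuous.comp_aestronglyMeasurable hU.memLp_lim.1
  have key := energy_inequality (e := tDir n) (d := fun α => xDir α) (u := v)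
    (w := fun p => ψ p • V (v p)) (Dv := fun α => O.indicator (Dv α))
    (Dw := fun α p => fderiv ℝ ψ p (xDir α) • V (v p) + ψ p • O.indicator (Dv α) p)
    (Ψ := fun p => Φ (v p) - Φ 0) (W := fun k p => ψ p • Θ (U k p)) hO hv2 hvM hDvI
    (fun W hW hc hs => hu.integral_eq hΩ hU.memLp_lim hDv hDv2 hW hc hs) hψ
    (fun k => contDiff_smul_of_tsupport_subset hO hψ1 hψ.2.2 (hWC k))
    (fun k => tsupport_smul_subset_left ψ fun p => Θ (U k p))
    (hsmul hψ.1.continuous hψ.2.1) (fun α => ?_) ?_ (fun α => ?_)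
    ((hC.continuous.sub continuous_const).comp_aestronglyMeasurable hv2.1) hCΦ fun p q => ?_
  · simp only [integral_inner_indicator hO] at key
    refine le_trans (le_of_eq ?_) (key.trans (le_of_eq ?_))
    · refine Finset.sum_congr rfl fun α _ => setIntegral_congr_fun hO.measurableSet fun p hp => ?_
      simp only [hvu p hp, indicator_of_mem hp, Dv]
    · rw [← setIntegral_eq_integral_of_forall_compl_eq_zero (s := O)]
      · refine setIntegral_congr_fun hO.measurableSet fun p hp => ?_
        simp only [hvu p hp]
      · intro p hp
        rw [hψdz _ p hp, mul_zero]
  · refine (hsmul (hψ.continuous_fderiv_apply _) (hasCompactSupport_fderiv_apply hψ.2.1 _)).add ?_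
    obtain ⟨B, -, hB⟩ := hψ.exists_bound (xDir α)
    refine MemLp.of_le_mul (c := B) (hDvI α)
      (hψ.1.continuous.aestronglyMeasurable.smul (hDvI α).1) (ae_of_all _ fun p => ?_)
    rw [norm_smul]
    gcongr
    exact (hB p).1
  · obtain ⟨B, -, hB⟩ := hψ.exists_bound 0
    refine (tendsto_eLpNorm_of_le_mul (C := B) (fun k => ?_) t1).congr fun k =>
      eLpNorm_restrict_eq_of_forall_notMem (O := O) (fun p hp => by simp [hψz p hp]) 2
    filter_upwards [ae_restrict_mem hO.measurableSet] with p hp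
    rw [hvu p hp, ← smul_sub, norm_smul]
    gcongr
    exact (hB p).1
  · obtain ⟨B, -, hB⟩ := hψ.exists_bound (xDir α)
    have m1 : ∀ k, AEStronglyMeasurable (fun p => Θ (U k p) - V (u p)) (volume.restrict O) :=
      fun k => (hΘ.continuous.comp_aestronglyMeasurable (hU.memLp k).1).sub hmV
    have m2 : ∀ k, AEStronglyMeasurable (fun p =>
        fderiv ℝ (fun p => Θ (U k p)) p (xDir α) - Dv α p) (volume.restrict O) := fun k =>
      ((continuousOn_fderiv_apply hO (hWC k) _).aestronglyMeasurable hO.measurableSet).sub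
        (hDv2 α).1
    have s1 := tendsto_eLpNorm_of_le_mul (C := B)
      (f := fun k p => fderiv ℝ ψ p (xDir α) • (Θ (U k p) - V (u p)))
      (fun k => ae_of_all _ fun p => by rw [norm_smul]; gcongr; exact (hB p).2) t1
    have s2 := tendsto_eLpNorm_of_le_mul (C := B)
      (f := fun k p => ψ p • (fderiv ℝ (fun p => Θ (U k p)) p (xDir α) - Dv α p))
      (fun k => ae_of_all _ fun p => by rw [norm_smul]; gcongr; exact (hB p).1) (t2 α)
    refine (tendsto_eLpNorm_add
      (fun k => (hψ.continuous_fderiv_apply _).aestronglyMeasurable.smul (m1 k))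
      (fun k => hψ.1.continuous.aestronglyMeasurable.smul (m2 k)) s1 s2).congr fun k => ?_
    simp only [fderiv_smul_apply_of_tsupport_subset hO hψ1 hψ.2.2 (hWC k)]
    rw [← eLpNorm_restrict_eq_of_forall_notMem (O := O)
      (fun p hp => by simp [hψz p hp, hψdz _ p hp]) 2]
    refine eLpNorm_congr_ae ?_
    filter_upwards [ae_restrict_mem hO.measurableSet] with p hp
    rw [hvu p hp, indicator_of_mem hp]
    simp only [Pi.smul_apply', smul_sub]
    abel
  · have h1 := inner_gradient_le_sub hC hconv (v p) (v q)
    rw [inner_smul_right, real_inner_comm]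
    refine mul_le_mul_of_nonneg_left ?_ (hψ0 p)
    rw [sub_sub_sub_cancel_right]
    exact h1

/-- The differential inequality for `Φ(u) - Φ(0)`, tested with smooth functions. -/
theorem IsWeakSolution.test_inequality (hΩ : IsOpen Ω) (hC : ContDiff ℝ 2 Φ) {lam : ℝ}
    (hlam : 0 < lam) (hlow : ∀ z ξ, lam * ‖ξ‖ ^ 2 ≤ fderiv ℝ (fderiv ℝ Φ) z ξ ξ)
    (hu : IsWeakSolution Ω T Φ u)
    (hM : ∀ᵐ p ∂(volume.restrict (cylinder Ω T)), ‖u p‖ ≤ M)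
    {U : ℕ → SpaceTime n → EuclideanSpace ℝ (Fin N)} (hU : C1Approx (cylinder Ω T) U u)
    (hDU : ∀ α, DerivTendsto (cylinder Ω T) (xDir α) U (Du α)) {ψ : SpaceTime n → ℝ}
    (hψ : IsTestFunction (cylinder Ω T) ψ) (hψ0 : ∀ p, 0 ≤ ψ p) :
    ∫ p in cylinder Ω T, lam ^ 2 * gradSq Du p * ψ p ≤
      (∫ p in cylinder Ω T, (Φ (u p) - Φ 0) * fderiv ℝ ψ p (tDir n)) -
        ∑ α, ∫ p in cylinder Ω T, inner ℝ (gradient Φ (u p))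
          (fderiv ℝ (gradient Φ) (u p) (Du α p)) * fderiv ℝ ψ p (xDir α) := by
  have h := hu.energy hΩ hC (fun z ξ => (by positivity : 0 ≤ lam * ‖ξ‖ ^ 2).trans (hlow z ξ))
    hM hU hDU hψ hψ0
  have hO : IsOpen (cylinder Ω T) := isOpen_cylinder hΩ
  set O := cylinder Ω T
  have hV : ContDiff ℝ 1 (gradient Φ) := contDiff_gradient hC
  obtain ⟨-, hDv2⟩ := hasWeakGrad_comp hΩ hU hDU hM hV
  obtain ⟨CV, hCV⟩ := (isCompact_closedBall (0 : EuclideanSpace ℝ (Fin N))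
    M).exists_bound_of_continuousOn hV.continuous.continuousOn
  obtain ⟨B, -, hB⟩ := hψ.exists_bound 0
  have hbdd : ∀ {f : SpaceTime n → ℝ}, Integrable f (volume.restrict O) →
      Integrable (fun p => f p * ψ p) (volume.restrict O) := fun hf =>
    hf.mul_bdd (c := B) hψ.1.continuous.aestronglyMeasurable (ae_of_all _ fun p => (hB p).1)
  have i1 : ∀ α, Integrable (fun p => ‖Du α p‖ ^ 2) (volume.restrict O) := fun α =>
    ((memLp_two_iff_integrable_sq_norm (hDU α).1.1).1 (hDU α).1)
  have i2 : ∀ α, Integrable (fun p => ‖fderiv ℝ (gradient Φ) (u p) (Du α p)‖ ^ 2 * ψ p)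
      (volume.restrict O) := fun α =>
    hbdd ((memLp_two_iff_integrable_sq_norm (hDv2 α).1).1 (hDv2 α))
  have i3 : ∀ α, Integrable (fun p => inner ℝ (gradient Φ (u p))
      (fderiv ℝ (gradient Φ) (u p) (Du α p)) * fderiv ℝ ψ p (xDir α)) (volume.restrict O) := by
    intro α
    have hm := hV.continuous.comp_aestronglyMeasurable hU.memLp_lim.1
    have h1 : MemLp (fun p => inner ℝ (gradient Φ (u p))
        (fderiv ℝ (gradient Φ) (u p) (Du α p))) 2 (volume.restrict O) := by
      refine MemLp.of_le_mul (c := CV) (hDv2 α) (hm.inner (hDv2 α).1) ?_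
      filter_upwards [hM] with p hp
      refine (norm_inner_le_norm _ _).trans ?_
      gcongr
      exact hCV _ (mem_closedBall_zero_iff.2 hp)
    have h2 : MemLp (fun p => fderiv ℝ ψ p (xDir α)) 2 (volume.restrict O) :=
      (hψ.continuous_fderiv_apply _).memLp_of_hasCompactSupport
        (hasCompactSupport_fderiv_apply hψ.2.1 _)
    exact h1.integrable_mul h2
  have e1 : ∀ α, ∫ p in O, inner ℝ (fderiv ℝ (gradient Φ) (u p) (Du α p))
        (fderiv ℝ ψ p (xDir α) • gradient Φ (u p) +
          ψ p • fderiv ℝ (gradient Φ) (u p) (Du α p)) =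
      (∫ p in O, inner ℝ (gradient Φ (u p))
        (fderiv ℝ (gradient Φ) (u p) (Du α p)) * fderiv ℝ ψ p (xDir α)) +
      ∫ p in O, ‖fderiv ℝ (gradient Φ) (u p) (Du α p)‖ ^ 2 * ψ p := by
    intro α
    rw [← integral_add (i3 α) (i2 α)]
    congr 1
    funext p
    rw [inner_add_right, inner_smul_right, inner_smul_right, real_inner_self_eq_norm_sq,
      real_inner_comm]
    ring
  simp only [e1, Finset.sum_add_distrib] at h
  -- The lower Hessian bound enters here quantitatively, direction by direction, as `lam |u_α| ≤
  -- |D²Φ(u) u_α|` squared.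
  have e2 : ∫ p in O, lam ^ 2 * gradSq Du p * ψ p ≤
      ∑ α, ∫ p in O, ‖fderiv ℝ (gradient Φ) (u p) (Du α p)‖ ^ 2 * ψ p := by
    rw [← integral_finsetSum _ fun α _ => i2 α]
    refine integral_mono (hbdd ((integrable_finsetSum _ fun α _ => i1 α).const_mul _))
      (integrable_finsetSum _ fun α _ => i2 α) fun p => ?_
    simp only [gradSq]
    rw [← Finset.sum_mul, Finset.mul_sum]
    refine mul_le_mul_of_nonneg_right (Finset.sum_le_sum fun α _ => ?_) (hψ0 p)
    rw [← mul_pow]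
    have := mul_norm_le_norm_fderiv_gradient hC hlow (u p) (Du α p)
    gcongr
  linarith

end Solution

/-! ### A smooth absolute value -/

section SmoothAbs

/-- A smooth approximation of the absolute value, vanishing at the origin. -/
noncomputable def smoothAbs (ε s : ℝ) : ℝ := √(s ^ 2 + ε ^ 2) - ε

variable {ε : ℝ}

theorem contDiff_smoothAbs (hε : 0 < ε) : ContDiff ℝ ∞ (smoothAbs ε) := by
  refine ContDiff.sub (ContDiff.sqrt (by fun_prop) fun s => ?_) contDiff_const
  positivity

theorem hasDerivAt_smoothAbs (hε : 0 < ε) (s : ℝ) :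
    HasDerivAt (smoothAbs ε) (s / √(s ^ 2 + ε ^ 2)) s := by
  have h1 : HasDerivAt (fun s : ℝ => s ^ 2 + ε ^ 2) (2 * s) s := by
    simpa using (hasDerivAt_pow 2 s).add_const (ε ^ 2)
  refine ((h1.sqrt (by positivity)).sub_const ε).congr_deriv ?_
  rw [mul_div_mul_left _ _ two_ne_zero]

theorem smoothAbs_zero (hε : 0 < ε) : smoothAbs ε 0 = 0 := by
  simp [smoothAbs, Real.sqrt_sq hε.le]

theorem smoothAbs_nonneg (ε s : ℝ) : 0 ≤ smoothAbs ε s := by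
  rw [smoothAbs, sub_nonneg]
  exact Real.le_sqrt_of_sq_le (by nlinarith [sq_nonneg s])

theorem abs_div_sqrt_le_one (ε s : ℝ) : |s / √(s ^ 2 + ε ^ 2)| ≤ 1 := by
  rw [abs_div, abs_of_nonneg (Real.sqrt_nonneg _)]
  refine div_le_one_of_le₀ ?_ (Real.sqrt_nonneg _)
  exact Real.abs_le_sqrt (by nlinarith [sq_nonneg ε])

theorem fderiv_smoothAbs_apply (hε : 0 < ε) (s t : ℝ) :
    fderiv ℝ (smoothAbs ε) s t = s / √(s ^ 2 + ε ^ 2) * t := by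
  rw [(hasDerivAt_smoothAbs hε s).hasFDerivAt.fderiv]
  simp [mul_comm]

theorem norm_fderiv_smoothAbs_le (hε : 0 < ε) (s : ℝ) : ‖fderiv ℝ (smoothAbs ε) s‖ ≤ 1 := by
  refine ContinuousLinearMap.opNorm_le_bound _ zero_le_one fun t => ?_
  rw [fderiv_smoothAbs_apply hε, norm_mul]
  exact mul_le_mul_of_nonneg_right (abs_div_sqrt_le_one ε s) (norm_nonneg t)

theorem tendsto_smoothAbs {e x : ℕ → ℝ} (he : Tendsto e atTop (𝓝 0)) {s : ℝ}
    (hx : Tendsto x atTop (𝓝 s)) : Tendsto (fun k => smoothAbs (e k) (x k)) atTop (𝓝 |s|) := by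
  have h := (Real.continuous_sqrt.tendsto _).comp ((hx.pow 2).add (he.pow 2))
  have := h.sub he
  simpa [smoothAbs, Real.sqrt_sq_eq_abs] using this

/-- Positivity of the limit is essential: at `s = 0` the quotient depends on the relative rates of
`x` and `e`. That case is handled through the vanishing of the weak derivative. -/
theorem tendsto_div_sqrt {e x : ℕ → ℝ} (he : Tendsto e atTop (𝓝 0)) {s : ℝ} (hs : 0 < s)
    (hx : Tendsto x atTop (𝓝 s)) :
    Tendsto (fun k => x k / √(x k ^ 2 + e k ^ 2)) atTop (𝓝 1) := by
  have h := (Real.continuous_sqrt.tendsto _).comp ((hx.pow 2).add (he.pow 2))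
  have h0 : √(s ^ 2 + 0 ^ 2) = s := by simp [Real.sqrt_sq hs.le]
  rw [h0] at h
  have := hx.div h hs.ne'
  rwa [div_self hs.ne'] at this

end SmoothAbs

/-! ### Nonnegative approximations of nonnegative `H¹₀` functions -/

section Nonneg

variable {n : ℕ} {O : Set (SpaceTime n)} {W : ℕ → SpaceTime n → ℝ} {v g : SpaceTime n → ℝ}
  {e : SpaceTime n}

theorem one_div_succ_pos (k : ℕ) : (0 : ℝ) < 1 / (k + 1) := Nat.one_div_pos_of_nat

/-- The weak derivative of a nonnegative function vanishes where the function does. -/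
theorem ae_deriv_eq_zero_of_eq_zero (hO : IsOpen O) (h : C1Approx O W v)
    (hg : DerivTendsto O e W g) (hv : ∀ᵐ p ∂(volume.restrict O), 0 ≤ v p) :
    ∀ᵐ p ∂(volume.restrict O), v p = 0 → g p = 0 := by
  have ht := tendsto_one_div_add_atTop_nhds_zero_nat (𝕜 := ℝ)
  have hC : ∀ k : ℕ, ContDiff ℝ 1 (smoothAbs (1 / (k + 1))) := fun k =>
    (contDiff_smoothAbs (one_div_succ_pos k)).of_le (by simp)
  have hb := fun k : ℕ => norm_fderiv_smoothAbs_le (one_div_succ_pos k)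
  have hk := fun k : ℕ => h.hasWeakDeriv_comp hO hg (hC k) (hb k)
  have hm := fun k : ℕ => (h.comp (hC k) (hb k) (smoothAbs_zero (one_div_succ_pos k))).memLp_lim
  have hmg := fun k : ℕ => (hg.comp hO h (hC k) (hb k)).1
  let A : Set (SpaceTime n) := {p | v p ≠ 0}
  have l1 : ∀ᵐ p ∂(volume.restrict O),
      Tendsto (fun k : ℕ => smoothAbs (1 / (k + 1)) (v p)) atTop (𝓝 (v p)) := by
    filter_upwards [hv] with p hp
    have := tendsto_smoothAbs ht (tendsto_const_nhds (x := v p))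
    rwa [abs_of_nonneg hp] at this
  have l2 : ∀ᵐ p ∂(volume.restrict O), Tendsto
      (fun k : ℕ => fderiv ℝ (smoothAbs (1 / (k + 1))) (v p) (g p)) atTop
      (𝓝 (A.indicator g p)) := by
    filter_upwards [hv] with p hp
    simp only [fderiv_smoothAbs_apply (one_div_succ_pos _)]
    rcases hp.eq_or_lt with h0 | h0
    · have : p ∉ A := fun h => h h0.symm
      rw [indicator_of_notMem this]
      simp [← h0]
    · have : p ∈ A := h0.ne'
      rw [indicator_of_mem this]
      simpa using (tendsto_div_sqrt ht h0 (tendsto_const_nhds (x := v p))).mul_const (g p)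
  have hbg : ∀ (k : ℕ) p, ‖fderiv ℝ (smoothAbs (1 / (k + 1))) (v p) (g p)‖ ≤ ‖g p‖ := fun k p => by
    simpa using (fderiv ℝ (smoothAbs (1 / (k + 1))) (v p)).le_of_opNorm_le (hb k _) (g p)
  have hbv : ∀ (k : ℕ) p, ‖smoothAbs (1 / (k + 1)) (v p)‖ ≤ ‖v p‖ := fun k p => by
    have := norm_sub_le_of_fderiv_le (hC k) (hb k) (v p) 0
    simpa only [smoothAbs_zero (one_div_succ_pos k), sub_zero, one_mul] using this
  have hAm : MemLp (A.indicator g) 2 (volume.restrict O) :=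
    hg.1.mono (aestronglyMeasurable_of_tendsto_ae _ (fun k => (hmg k).1) l2)
      (ae_of_all _ fun p => norm_indicator_le_norm_self _ _)
  -- Regularized absolute values of `v` converge to `v`, while their derivatives converge to `g`
  -- restricted to `{v ≠ 0}`. By uniqueness this restriction is `g` itself.
  have h1 : HasWeakDeriv O e v (A.indicator g) := by
    refine HasWeakDeriv.of_tendsto hk hm hmg h.memLp_lim hAm ?_ ?_
    · exact tendsto_eLpNorm_two_of_dominated h.memLp_lim.norm (fun k => (hm k).1)
        (fun k => ae_of_all _ (hbv k)) l1
    · exact tendsto_eLpNorm_two_of_dominated hg.1.norm (fun k => (hmg k).1)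
        (fun k => ae_of_all _ (hbg k)) l2
  filter_upwards [h1.ae_eq hO (h.hasWeakDeriv hO hg)] with p hp h0
  have : p ∉ A := fun h => h h0
  rw [← hp, indicator_of_notMem this]

/-- Replacing the approximations `W k` of a nonnegative function by `smoothAbs (1/(k+1)) (W k)`. -/
theorem tendsto_eLpNorm_fderiv_smoothAbs (hO : IsOpen O) (hW : ∀ k, IsTestFunction O (W k))
    (h : C1Approx O W v) (hg : DerivTendsto O e W g)
    (hv : ∀ᵐ p ∂(volume.restrict O), 0 ≤ v p) :
    Tendsto (fun k : ℕ => eLpNorm (fun p =>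
      fderiv ℝ (fun p => smoothAbs (1 / (k + 1)) (W k p)) p e - g p) 2 (volume.restrict O))
      atTop (𝓝 0) := by
  have ht := tendsto_one_div_add_atTop_nhds_zero_nat (𝕜 := ℝ)
  let a : ℕ → SpaceTime n → ℝ := fun k p => W k p / √(W k p ^ 2 + (1 / (k + 1 : ℝ)) ^ 2)
  have ha : ∀ k, Continuous (a k) := fun k => by
    have h1 := (hW k).1.continuous
    have h2 := one_div_succ_pos k
    refine h1.div (by fun_prop) fun p => ?_
    positivity
  have ha1 : ∀ k p, ‖a k p‖ ≤ 1 := fun k p => abs_div_sqrt_le_one _ _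
  have hd : ∀ (k : ℕ) p, fderiv ℝ (fun p => smoothAbs (1 / (k + 1)) (W k p)) p e =
      a k p * fderiv ℝ (W k) p e := fun k p => by
    have h1 := (hasDerivAt_smoothAbs (one_div_succ_pos k) (W k p)).comp_hasFDerivAt p
      ((hW k).1.differentiable (by simp) p).hasFDerivAt
    rw [show (fun p => smoothAbs (1 / (k + 1)) (W k p)) = smoothAbs (1 / (k + 1)) ∘ W k from rfl,
      h1.fderiv]
    simp [a]
  have hgm := h.aestronglyMeasurable_fderiv hO e
  have t1 : Tendsto (fun k => eLpNorm (fun p => a k p * (fderiv ℝ (W k) p e - g p)) 2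
      (volume.restrict O)) atTop (𝓝 0) := by
    refine tendsto_eLpNorm_of_le_mul (C := 1) (fun k => ae_of_all _ fun p => ?_) hg.2
    rw [norm_mul]
    exact mul_le_mul_of_nonneg_right (ha1 k p) (norm_nonneg _)
  have t2 : Tendsto (fun k => eLpNorm (fun p => a k p * g p - g p) 2 (volume.restrict O))
      atTop (𝓝 0) := by
    refine tendsto_eLpNorm_two_of_dominated hg.1.norm
      (fun k => (ha k).aestronglyMeasurable.mul hg.1.1) (fun k => ae_of_all _ fun p => ?_) ?_
    · rw [norm_mul]
      exact mul_le_of_le_one_left (norm_nonneg _) (ha1 k p)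
    -- Where `v > 0` the factor `a k` tends to `1`; where `v = 0` it need not converge, but `g = 0`
    -- there.
    · filter_upwards [hv, h.tendsto_ae, ae_deriv_eq_zero_of_eq_zero hO h hg hv] with p h1 h2 h3
      rcases h1.eq_or_lt with h0 | h0
      · simp [h3 h0.symm]
      · simpa [a] using (tendsto_div_sqrt ht h0 h2).mul_const (g p)
  refine (tendsto_eLpNorm_add
    (fun k => (ha k).aestronglyMeasurable.mul ((hgm k).sub hg.1.1))
    (fun k => ((ha k).aestronglyMeasurable.mul hg.1.1).sub hg.1.1) t1 t2).congr fun k => ?_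
  congr 1
  funext p
  rw [hd]
  simp only [Pi.mul_apply, Pi.sub_apply]
  ring

theorem isTestFunction_smoothAbs {ε : ℝ} (hε : 0 < ε) {ψ : SpaceTime n → ℝ}
    (hψ : IsTestFunction O ψ) : IsTestFunction O fun p => smoothAbs ε (ψ p) :=
  ⟨(contDiff_smoothAbs hε).comp hψ.1, hψ.2.1.comp_left (smoothAbs_zero hε),
    (closure_mono (Function.support_comp_subset (smoothAbs_zero hε) ψ)).trans hψ.2.2⟩

end Nonneg

/-! ### Zero mean of the time derivative -/

section TimeDerivative

variable {n : ℕ} {Ω : Set (EuclideanSpace ℝ (Fin n))} {T : ℝ}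

/-- The time derivative of an element of `H¹₀(Ω_T)` has zero mean, if it is integrable. -/
theorem MemH10.integral_time_deriv_eq_zero (hΩ : IsOpen Ω) {v vt : SpaceTime n → ℝ}
    {Dv : Fin n → SpaceTime n → ℝ} (hv : MemH10 (cylinder Ω T) v vt Dv) {c : ℝ}
    (hi : IntegrableOn (fun p => c * vt p) (cylinder Ω T)) :
    ∫ p in cylinder Ω T, c * vt p = 0 := by
  have hO : IsOpen (cylinder Ω T) := isOpen_cylinder hΩ
  obtain ⟨W, hW, hWv, hWt, -⟩ := hv.exists_approx
  -- The cutoff depends on `x` only, so it commutes with the time derivative; as `(0, T)` is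
  -- bounded, it is square integrable on the cylinder.
  let χ : ∀ _ : ℕ, ContDiffBump (0 : EuclideanSpace ℝ (Fin n)) := fun R =>
    ⟨R + 1, R + 2, by positivity, by linarith⟩
  let η : ℕ → SpaceTime n → ℝ := fun R p => χ R p.1
  have hη : ∀ R, ContDiff ℝ 1 (η R) := fun R => (χ R).contDiff.comp contDiff_fst
  have hη1 : ∀ R p, ‖η R p‖ ≤ 1 := fun R p => by
    rw [Real.norm_of_nonneg (χ R).nonneg]
    exact (χ R).le_one
  have hηt : ∀ R p, fderiv ℝ (η R) p (tDir n) = 0 := fun R p => by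
    have h1 := (((χ R).contDiff (n := 1)).differentiable (by norm_num) p.1).hasFDerivAt.comp p
      (hasFDerivAt_fst (𝕜 := ℝ) (p := p))
    rw [show η R = (χ R) ∘ Prod.fst from rfl, h1.fderiv]
    simp [tDir]
  have hη2 : ∀ R, MemLp (η R) 2 (volume.restrict (cylinder Ω T)) := fun R => by
    let K : Set (SpaceTime n) := Metric.closedBall 0 (R + 2) ×ˢ Icc 0 T
    have hK : IsCompact K := (isCompact_closedBall _ _).prod isCompact_Icc
    have h1 : MemLp (K.indicator fun _ => (1 : ℝ)) 2 (volume.restrict (cylinder Ω T)) :=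
      memLp_indicator_const 2 hK.measurableSet _ (Or.inr hK.measure_lt_top.ne)
    refine h1.mono (hη R).continuous.aestronglyMeasurable ?_
    filter_upwards [ae_restrict_mem hO.measurableSet] with p hp
    by_cases hpK : p ∈ K
    · rw [indicator_of_mem hpK]
      simpa using hη1 R p
    · have : p.1 ∉ Metric.ball (0 : EuclideanSpace ℝ (Fin n)) (R + 2) := fun h =>
        hpK ⟨Metric.ball_subset_closedBall h, Ioo_subset_Icc_self hp.2⟩
      have h0 : η R p = 0 := by
        rw [← Function.notMem_support]
        change p.1 ∉ Function.support (χ R)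
        rwa [(χ R).support_eq]
      simp [h0]
  have hz : ∀ R, ∫ p in cylinder Ω T, η R p * vt p = 0 := by
    intro R
    have h1 := tendsto_integral_bilin (ContinuousLinearMap.mul ℝ ℝ) (hη2 R)
      (fun k => (((hW k).continuous_fderiv_apply (tDir n)).memLp_of_hasCompactSupport (p := 2)
        (μ := volume.restrict (cylinder Ω T)) (hasCompactSupport_fderiv_apply (hW k).2.1 _)))
      hWt.1 hWt.2
    simp only [ContinuousLinearMap.mul_apply'] at h1
    refine tendsto_nhds_unique h1 (tendsto_const_nhds.congr fun k => ?_)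
    have hWk : ContDiff ℝ 1 (W k) := (hW k).1.of_le (by simp)
    have h2 := integral_fderiv_apply_eq_zero ((hη R).smul hWk) ((hW k).2.1.smul_left (f := η R))
      (tDir n)
    rw [setIntegral_eq_integral_of_forall_compl_eq_zero, ← h2]
    · congr 1
      funext p
      rw [fderiv_smul ((hη R).differentiable (by norm_num) p) (hWk.differentiable (by norm_num) p)]
      simp [hηt R p]
    · intro p hp
      rw [image_eq_zero_of_notMem_tsupport (f := fun p => fderiv ℝ (W k) p (tDir n)) fun h =>
        hp ((hW k).2.2 (tsupport_fderiv_apply_subset_tsupport _ h)), mul_zero]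
  -- Integrability is assumed for `c * vt` rather than `vt`, so the case `c = 0` asks for nothing;
  -- it provides the dominating function as `R → ∞`.
  have hlim : Tendsto (fun R => ∫ p in cylinder Ω T, η R p * (c * vt p)) atTop
      (𝓝 (∫ p in cylinder Ω T, c * vt p)) := by
    refine tendsto_integral_of_dominated_convergence (fun p => ‖c * vt p‖)
      (fun R => (hη R).continuous.aestronglyMeasurable.mul hi.1) hi.norm
      (fun R => ae_of_all _ fun p => ?_) (ae_of_all _ fun p => ?_)
    · rw [norm_mul]
      exact mul_le_of_le_one_left (norm_nonneg _) (hη1 R p)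
    · refine tendsto_const_nhds.congr' ?_
      filter_upwards [eventually_ge_atTop ⌈‖p.1‖⌉₊] with R hR
      have h1 : ‖p.1‖ ≤ R := (Nat.le_ceil _).trans (Nat.cast_le.2 hR)
      have h2 : η R p = 1 := (χ R).one_of_mem_closedBall (by
        rw [mem_closedBall_zero_iff]
        change ‖p.1‖ ≤ (R : ℝ) + 1
        linarith)
      rw [h2, one_mul]
  refine tendsto_nhds_unique hlim (tendsto_const_nhds.congr fun R => ?_)
  have : ∀ p, η R p * (c * vt p) = c * (η R p * vt p) := fun p => by ring
  simp only [this]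
  rw [integral_const_mul, hz, mul_zero]

end TimeDerivative

/-- A real-valued form of Fatou's lemma. -/
theorem integrable_and_integral_le_of_tendsto_ae {α : Type*} [MeasurableSpace α] {μ : Measure α}
    {f : ℕ → α → ℝ} {f₀ : α → ℝ} {R : ℕ → ℝ} {R₀ : ℝ} (hf : ∀ k, Integrable (f k) μ)
    (hf0 : ∀ k, 0 ≤ᵐ[μ] f k) (hlim : ∀ᵐ x ∂μ, Tendsto (fun k => f k x) atTop (𝓝 (f₀ x)))
    (hle : ∀ k, ∫ x, f k x ∂μ ≤ R k) (hR : Tendsto R atTop (𝓝 R₀)) :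
    Integrable f₀ μ ∧ ∫ x, f₀ x ∂μ ≤ R₀ := by
  have hm : AEStronglyMeasurable f₀ μ := aestronglyMeasurable_of_tendsto_ae _
    (fun k => (hf k).1) hlim
  have h0 : 0 ≤ᵐ[μ] f₀ := by
    filter_upwards [ae_all_iff.2 hf0, hlim] with x h1 h2
    exact ge_of_tendsto h2 (Eventually.of_forall h1)
  have hR0 : 0 ≤ R₀ := ge_of_tendsto hR (Eventually.of_forall fun k =>
    (integral_nonneg_of_ae (hf0 k)).trans (hle k))
  have h1 : ∫⁻ x, ENNReal.ofReal (f₀ x) ∂μ ≤ ENNReal.ofReal R₀ := by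
    calc ∫⁻ x, ENNReal.ofReal (f₀ x) ∂μ
        = ∫⁻ x, liminf (fun k => ENNReal.ofReal (f k x)) atTop ∂μ := by
          refine lintegral_congr_ae ?_
          filter_upwards [hlim] with x hx
          exact ((ENNReal.continuous_ofReal.tendsto _).comp hx).liminf_eq.symm
      _ ≤ liminf (fun k => ∫⁻ x, ENNReal.ofReal (f k x) ∂μ) atTop :=
          lintegral_liminf_le' fun k => (hf k).1.aemeasurable.ennreal_ofReal
      _ ≤ liminf (fun k => ENNReal.ofReal (R k)) atTop := by
          refine liminf_le_liminf (Eventually.of_forall fun k => ?_)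
          rw [← ofReal_integral_eq_lintegral_ofReal (hf k) (hf0 k)]
          exact ENNReal.ofReal_le_ofReal (hle k)
      _ = ENNReal.ofReal R₀ := ((ENNReal.continuous_ofReal.tendsto _).comp hR).liminf_eq
  refine ⟨⟨hm, (hasFiniteIntegral_iff_ofReal h0).2 (h1.trans_lt ENNReal.ofReal_lt_top)⟩, ?_⟩
  rw [integral_eq_lintegral_of_nonneg_ae h0 hm]
  exact ENNReal.toReal_le_of_le_ofReal hR0 h1

theorem fderiv_half_norm_sq_apply {E H : Type*} [NormedAddCommGroup E] [NormedSpace ℝ E]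
    [NormedAddCommGroup H] [InnerProductSpace ℝ H] {V : E → H} (hV : ContDiff ℝ 1 V) (z ξ : E) :
    fderiv ℝ (fun z => 1 / 2 * ‖V z‖ ^ 2) z ξ = inner ℝ (V z) (fderiv ℝ V z ξ) := by
  have h := ((hV.differentiable (by norm_num) z).hasFDerivAt.norm_sq).const_mul (1 / 2)
  rw [h.fderiv]
  simp

end DiffusionSystem

/-! ### From smooth to general nonnegative test functions -/

theorem mainTheorem9 {n N : ℕ} (hN : 1 ≤ N)
    (Ω : Set (EuclideanSpace ℝ (Fin n))) (hΩ : IsOpen Ω) (T : ℝ) (hT : 0 < T)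
    (Φ : EuclideanSpace ℝ (Fin N) → ℝ) (lam Lam : ℝ)
    (hΦ : DiffusionSystem.IsUniformlyConvex Φ lam Lam)
    (φ : ℝ → ℝ) (hφ : ∀ z : EuclideanSpace ℝ (Fin N), Φ z = φ ‖z‖)
    (u : DiffusionSystem.SpaceTime n → EuclideanSpace ℝ (Fin N))
    (hu : DiffusionSystem.IsWeakSolution Ω T Φ u)
    (hub : DiffusionSystem.IsBoundedOn Ω T u)
    (Du : Fin n → DiffusionSystem.SpaceTime n → EuclideanSpace ℝ (Fin N))
    (hDu : DiffusionSystem.HasWeakGrad (DiffusionSystem.cylinder Ω T) u Du) :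
    ∃ γ : ℝ → ℝ, ContDiff ℝ 1 γ ∧ StrictMono γ ∧
      (∀ z : ℝ, 0 ≤ z → γ (φ z) = 1 / 2 * (derivWithin φ (Set.Ici 0) z) ^ 2) ∧
      DiffusionSystem.WeaklySatisfiesLE Ω T γ (fun p => φ ‖u p‖)
        (fun p => lam ^ 2 * DiffusionSystem.gradSq Du p) := by
  open DiffusionSystem in
  obtain ⟨γ, hγ1, hγ2, hγ3, hγ4⟩ := exists_gamma hN hΦ hφ
  refine ⟨γ, hγ1, hγ2, hγ3, ?_⟩
  obtain ⟨hlam, hC, hH⟩ := hΦ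
  have hlow : ∀ z ξ, lam * ‖ξ‖ ^ 2 ≤ fderiv ℝ (fderiv ℝ Φ) z ξ ξ := fun z ξ => by
    simpa [iteratedFDeriv_two_apply] using (hH z ξ).1
  obtain ⟨M, hM⟩ := hub
  have hO : IsOpen (cylinder Ω T) := isOpen_cylinder hΩ
  obtain ⟨U, hU, hDU⟩ := hu.1.exists_approx hΩ hDu
  have hV : ContDiff ℝ 1 (gradient Φ) := contDiff_gradient hC
  set μ := volume.restrict (cylinder Ω T)
  set G : Fin n → SpaceTime n → ℝ := fun α p =>
    inner ℝ (gradient Φ (u p)) (fderiv ℝ (gradient Φ) (u p) (Du α p))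
  obtain ⟨hG, hG2⟩ : HasWeakGrad (cylinder Ω T) (fun p => γ (φ ‖u p‖)) G ∧
      ∀ α, MemLp (G α) 2 μ := by
    have := hasWeakGrad_comp hΩ hU hDU hM
      (Θ := fun z => 1 / 2 * ‖gradient Φ z‖ ^ 2) (contDiff_const.mul (hV.norm_sq ℝ))
    simp only [fderiv_half_norm_sq_apply hV] at this
    simpa only [hγ4] using this
  refine ⟨G, hG, hG2, fun v vt Dv hv hv0 hi => ?_⟩
  simp only [← hφ] at hi ⊢
  -- A Lipschitz replacement of `Φ` gives `|Φ(u) - Φ(0)| ≤ C |u|`, hence square integrability; `max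
  -- M 0` ensures that the ball contains the origin.
  obtain ⟨Θ, hΘ, ⟨C, hΘC⟩, hΘΦ⟩ := exists_contDiff_bounded_fderiv
    (hC.of_le (show (1 : WithTop ℕ∞) ≤ 2 by norm_num)) (max M 0)
  have hg2 : MemLp (fun p => Φ (u p) - Φ 0) 2 μ := by
    refine MemLp.of_le_mul (c := C) hU.memLp_lim
      ((hC.continuous.comp_aestronglyMeasurable hU.memLp_lim.1).sub aestronglyMeasurable_const) ?_
    filter_upwards [hM] with p hp
    rw [← (hΘΦ (u p) (hp.trans (le_max_left _ _))).1, ← (hΘΦ 0 (by simp)).1]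
    simpa using norm_sub_le_of_fderiv_le hΘ hΘC (u p) 0
  have hq : Integrable (fun p => lam ^ 2 * gradSq Du p) μ :=
    (integrable_finsetSum _ fun α _ =>
      (memLp_two_iff_integrable_sq_norm (hDU α).1.1).1 (hDU α).1).const_mul _
  have hq0 : ∀ p, 0 ≤ lam ^ 2 * gradSq Du p := fun p =>
    mul_nonneg (sq_nonneg _) (Finset.sum_nonneg fun α _ => sq_nonneg _)
  obtain ⟨W, hW, hWv, hWt, hWx⟩ := hv.exists_approx
  let ψ : ℕ → SpaceTime n → ℝ := fun k p => smoothAbs (1 / (k + 1)) (W k p)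
  have hψ : ∀ k, IsTestFunction (cylinder Ω T) (ψ k) := fun k =>
    isTestFunction_smoothAbs (one_div_succ_pos k) (hW k)
  have hψ0 : ∀ k p, 0 ≤ ψ k p := fun k p => smoothAbs_nonneg _ _
  have hψm : ∀ k e, MemLp (fun p => fderiv ℝ (ψ k) p e) 2 μ := fun k e =>
    ((hψ k).continuous_fderiv_apply e).memLp_of_hasCompactSupport
      (hasCompactSupport_fderiv_apply (hψ k).2.1 e)
  have hlim : ∀ {f g : SpaceTime n → ℝ} {e : SpaceTime n}, MemLp f 2 μ →
      DerivTendsto (cylinder Ω T) e W g →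
      Tendsto (fun k => ∫ p, f p * fderiv ℝ (ψ k) p e ∂μ) atTop (𝓝 (∫ p, f p * g p ∂μ)) :=
    fun {f g e} hf hg => tendsto_integral_bilin (ContinuousLinearMap.mul ℝ ℝ) hf
      (fun k => hψm k e) hg.1 (tendsto_eLpNorm_fderiv_smoothAbs hO hW hWv hg hv0)
  -- `|∇u|²` is only in `L¹` and `v` only in `L²`, so integrability of the product is not known
  -- beforehand; Fatou extracts it from the convergent right-hand sides.
  have hfatou := integrable_and_integral_le_of_tendsto_ae (μ := μ)
    (f := fun k p => lam ^ 2 * gradSq Du p * ψ k p)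
    (f₀ := fun p => lam ^ 2 * gradSq Du p * v p) (fun k => ?_)
    (fun k => ae_of_all _ fun p => mul_nonneg (hq0 p) (hψ0 k p)) ?_
    (fun k => hu.test_inequality hΩ hC hlam hlow hM hU hDU (hψ k) (hψ0 k))
    ((hlim hg2 hWt).sub (tendsto_finsetSum _ fun α _ => hlim (hG2 α) (hWx α)))
  · obtain ⟨hint, hle⟩ := hfatou
    refine ⟨hint, ?_⟩
    have i1 : Integrable (fun p => (Φ (u p) - Φ 0) * vt p) μ := hg2.integrable_mul hWt.1
    have i2 : Integrable (fun p => Φ 0 * vt p) μ := by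
      refine (hi.sub i1).congr (ae_of_all _ fun p => ?_)
      simp only [Pi.sub_apply]
      ring
    have i3 : ∀ α, Integrable (fun p => G α p * Dv α p) μ := fun α =>
      (hG2 α).integrable_mul (hWx α).1
    -- The constant `Φ 0` contributes nothing because `Φ 0 * vt` is integrable with zero mean.
    have e1 : ∫ p, Φ (u p) * vt p ∂μ = ∫ p, (Φ (u p) - Φ 0) * vt p ∂μ := by
      have h1 := hv.integral_time_deriv_eq_zero hΩ i2
      rw [← add_zero (∫ p, (Φ (u p) - Φ 0) * vt p ∂μ), ← h1, ← integral_add i1 i2]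
      congr 1
      funext p
      ring
    have i0 : Integrable (fun p => -(Φ (u p) * vt p)) μ := hi.neg
    have i4 : Integrable (fun p => ∑ α, G α p * Dv α p) μ :=
      integrable_finsetSum _ fun α _ => i3 α
    have i5 : Integrable (fun p => -(Φ (u p) * vt p) + ∑ α, G α p * Dv α p) μ := i0.add i4
    rw [integral_add i5 hint, integral_add i0 i4, integral_neg,
      integral_finsetSum _ fun α _ => i3 α, e1]
    linarith
  · obtain ⟨B, -, hB⟩ := (hψ k).exists_bound 0
    exact hq.mul_bdd (c := B) (hψ k).1.continuous.aestronglyMeasurable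
      (ae_of_all _ fun p => (hB p).1)
  · filter_upwards [hWv.tendsto_ae, hv0] with p h1 h2
    have := tendsto_smoothAbs (tendsto_one_div_add_atTop_nhds_zero_nat (𝕜 := ℝ)) h1
    rw [abs_of_nonneg h2] at this
    exact this.const_mul _
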